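/- Let $\mathcal A_*=\mathbb F_2[\xi_1,\xi_2,\dots]$ (with $\xi_0=1$) be the dual of the mod $2$ Steenrod algebra $\mathcal A$, with Milnor's coproduct $\Delta\xi_n=\sum_i \xi_{n-i}^{2^i}\otimes\xi_i$. For $m\ge 1$ let $E(m)\subset\mathcal A$ be the maximal elementary sub-Hopf algebra whose dual is the quotient Hopf algebra $$E(m)^*=\mathcal A_*/(\xi_1,\dots,\xi_{m-1},\xi_m^{2^m},\xi_{m+1}^{2^m},\dots).$$ *Cohomology.* Let $\overline{E(m)}$ be the augmentation ideal of $E(m)$ and $\overline{E(m)}{}^*=E(m)^*/\mathbb F_2\cdot 1$ its dual. $H^{*,*}(E(m))$ is the cohomology of the complex with $k$-th term $(\overline{E(m)}{}^*)^{\otimes k}$, $k \ge 0$, and differential $$\partial(a_1|\cdots|a_k)=\sum\chi(a_1'\cdots a_k')\,|\,a_1''|\cdots|a_k'',\qquad \Delta a_i=\sum a_i'\otimes a_i'',$$ where $\chi$ is the antipode; it is an algebra under the product induced by concatenation of cocycles (the Yoneda product). For $0\le s<m\le t$ the element $\xi_t^{2^s}$ is primitive in $E(m)^*$, and $h_{t,s}\in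 H^{1,*}(E(m))$ denotes the class of $[\xi_t^{2^s}]$. *Transfer.* Let $V_n=(\mathbb Z/2)^n$, and let $b_k\in H_k(B\mathbb Z/2)$ be dual to $x^k\in H^*(B\mathbb Z/2)=\mathbb F_2[x]$; the elements $b_{k_1}\cdots b_{k_n}$ form a basis of $H_*(BV_n)=H_*(B\mathbb Z/2)^{\otimes n}$, on which $\mathcal A$ acts from the right, dually to its action on cohomology. Let $P_{E(m)}H_*(BV_n)$ be the subspace of elements annihilated by $\overline{E(m)}$. The direct sum $\bigoplus_n P_{E(m)}H_*(BV_n)$ is an algebra under concatenation. The total $E(m)$-transfer is the algebra homomorphism $$\mathrm{Tr}^{E(m)}\colon \bigoplus_{n\ge0}P_{E(m)}H_*(BV_n)\to H^{*,*}(E(m))$$ which sends an annihilated element $\sum b_{k_1}\cdots b_{k_n}$ to the class of the cocycle $\sum f_*(b_{k_1})|\cdots|f_*(b_{k_n})$. Here $f_*(b_k)$ is the image in $\overline{E(m)}{}^*$ of the coefficient of $x^{k+1}$ in the inverse power series $\big(\sum_{t\ge0}\xi_t x^{2^t-1}\big)^{-1}$; equivalently, $f_*$ is dual to the map $\overline{\mathcal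 A}\to\mathbb F_2[x]$, $\theta\mapsto\theta(x^{-1})$. **Proposition.** For each $m\ge1$, the classes $h_{t,s}$ $(0\le s<m\le t)$ generate a polynomial subalgebra $\mathbb F_2[h_{t,s}\mid s<m\le t]$ of $H^{*,*}(E(m))$, that is, they commute and are algebraically independent; and the polynomial subalgebra $\mathbb F_2[h_{m,s}\mid 0\le s<m]$ is contained in the image of the total $E(m)$-transfer. -/

import Mathlib

open scoped TensorProduct

noncomputable section

/-- The dual `A_*` of the mod 2 Steenrod algebra, as an algebra: polynomials over `F_2` in
`ξ_1, ξ_2, …` (the variable with index `i` is `ξ_{i+1}`). -/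
def DualSteenrod : Type := MvPolynomial ℕ (ZMod 2)

namespace DualSteenrod

instance : CommRing DualSteenrod := inferInstanceAs (CommRing (MvPolynomial ℕ (ZMod 2)))

instance : Algebra (ZMod 2) DualSteenrod :=
  inferInstanceAs (Algebra (ZMod 2) (MvPolynomial ℕ (ZMod 2)))

/-- Milnor's generators `ξ_n`, with `ξ_0 = 1`. -/
def xi : ℕ → DualSteenrod
  | 0 => 1
  | n + 1 => (MvPolynomial.X n : MvPolynomial ℕ (ZMod 2))

/-- The algebra homomorphism `A_* → R` with `ξ_n ↦ r n` for `n ≥ 1`. -/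
def evalHom {R : Type*} [CommRing R] [Algebra (ZMod 2) R] (r : ℕ → R) :
    DualSteenrod →ₐ[ZMod 2] R :=
  (MvPolynomial.aeval fun n => r (n + 1) : MvPolynomial ℕ (ZMod 2) →ₐ[ZMod 2] R)

@[simp] theorem xi_zero : xi 0 = 1 := rfl

theorem evalHom_xi {R : Type*} [CommRing R] [Algebra (ZMod 2) R] (r : ℕ → R) (h : r 0 = 1)
    (n : ℕ) : evalHom r (xi n) = r n := by
  cases n with
  | zero => rw [xi_zero, map_one, h]
  | succ n => exact MvPolynomial.aeval_X _ n

theorem hom_ext {R : Type*} [Semiring R] [Algebra (ZMod 2) R]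
    {f g : DualSteenrod →ₐ[ZMod 2] R} (h : ∀ n, f (xi n) = g (xi n)) : f = g :=
  MvPolynomial.algHom_ext (σ := ℕ) (R := ZMod 2) fun n => h (n + 1)

theorem sum_pow_two_pow {R ι : Type*} [CommRing R] [Algebra (ZMod 2) R] (s : Finset ι)
    (f : ι → R) (k : ℕ) : (∑ i ∈ s, f i) ^ 2 ^ k = ∑ i ∈ s, f i ^ 2 ^ k := by
  rcases subsingleton_or_nontrivial R with h | h
  · exact Subsingleton.elim _ _
  · have : CharP R 2 := charP_of_injective_algebraMap (algebraMap (ZMod 2) R).injective 2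
    exact sum_pow_char_pow 2 k s f

/-- Milnor's coproduct `Δ ξ_n = ∑_i ξ_{n-i}^{2^i} ⊗ ξ_i`, extended multiplicatively. -/
def comulHom : DualSteenrod →ₐ[ZMod 2] DualSteenrod ⊗[ZMod 2] DualSteenrod :=
  evalHom fun n => ∑ p ∈ Finset.HasAntidiagonal.antidiagonal n, (xi p.1 ^ 2 ^ p.2) ⊗ₜ[ZMod 2] xi p.2

/-- The counit: `ξ_n ↦ 0` for `n ≥ 1`. -/
def counitHom : DualSteenrod →ₐ[ZMod 2] ZMod 2 := evalHom fun n => if n = 0 then 1 else 0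

theorem comulHom_xi (n : ℕ) : comulHom (xi n) =
    ∑ p ∈ Finset.HasAntidiagonal.antidiagonal n, (xi p.1 ^ 2 ^ p.2) ⊗ₜ[ZMod 2] xi p.2 :=
  evalHom_xi _ (by simp [Algebra.TensorProduct.one_def]) n

theorem counitHom_xi (n : ℕ) : counitHom (xi n) = if n = 0 then 1 else 0 :=
  evalHom_xi _ (by simp) n

instance : Bialgebra (ZMod 2) DualSteenrod :=
  Bialgebra.ofAlgHom comulHom counitHom
    (by
      apply hom_ext
      intro n
      simp only [AlgHom.comp_apply, comulHom_xi, map_sum, Algebra.TensorProduct.map_tmul, map_pow,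
        AlgHom.id_apply, sum_pow_two_pow, TensorProduct.sum_tmul, TensorProduct.tmul_sum,
        Algebra.TensorProduct.tmul_pow, ← pow_mul, ← pow_add]
      rw [Finset.sum_sigma', Finset.sum_sigma']
      refine Finset.sum_bij' (fun x _ => ⟨(x.2.1, x.2.2 + x.1.2), (x.2.2, x.1.2)⟩)
        (fun x _ => ⟨(x.1.1 + x.2.1, x.2.2), (x.1.1, x.2.1)⟩) ?_ ?_ ?_ ?_ ?_
      · rintro ⟨⟨a, b⟩, ⟨c, d⟩⟩ h
        simp only [Finset.mem_sigma, Finset.HasAntidiagonal.mem_antidiagonal, and_true] at h ⊢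
        omega
      · rintro ⟨⟨a, b⟩, ⟨c, d⟩⟩ h
        simp only [Finset.mem_sigma, Finset.HasAntidiagonal.mem_antidiagonal, and_true] at h ⊢
        omega
      · rintro ⟨⟨a, b⟩, ⟨c, d⟩⟩ h
        simp only [Finset.mem_sigma, Finset.HasAntidiagonal.mem_antidiagonal] at h
        obtain ⟨h1, rfl⟩ := h
        rfl
      · rintro ⟨⟨a, b⟩, ⟨c, d⟩⟩ h
        simp only [Finset.mem_sigma, Finset.HasAntidiagonal.mem_antidiagonal] at h
        obtain ⟨h1, rfl⟩ := h
        rfl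
      · rintro ⟨⟨a, b⟩, ⟨c, d⟩⟩ h
        simp [pow_add])
    (by
      apply hom_ext
      intro n
      simp only [AlgHom.comp_apply, comulHom_xi, map_sum, Algebra.TensorProduct.map_tmul, map_pow,
        AlgHom.id_apply, counitHom_xi]
      rw [Finset.sum_eq_single (0, n)]
      · simp
      · rintro ⟨a, b⟩ h1 h2
        have : a ≠ 0 := by
          rintro rfl
          simp at h1
          simp [h1] at h2
        simp [this]
      · simp)
    (by
      apply hom_ext
      intro n
      simp only [AlgHom.comp_apply, comulHom_xi, map_sum, Algebra.TensorProduct.map_tmul, map_pow,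
        AlgHom.id_apply, counitHom_xi]
      rw [Finset.sum_eq_single (n, 0)]
      · simp
      · rintro ⟨a, b⟩ h1 h2
        have : b ≠ 0 := by
          rintro rfl
          simp at h1
          simp [h1] at h2
        simp [this]
      · simp)

theorem comul_xi (n : ℕ) : Coalgebra.comul (R := ZMod 2) (xi n) =
    ∑ p ∈ Finset.HasAntidiagonal.antidiagonal n, (xi p.1 ^ 2 ^ p.2) ⊗ₜ[ZMod 2] xi p.2 :=
  comulHom_xi n

theorem counit_xi (n : ℕ) :
    Coalgebra.counit (R := ZMod 2) (xi n) = if n = 0 then 1 else 0 := counitHom_xi n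

/-- The conjugates `χ(ξ_n)`, determined by `∑_i ξ_{n-i}^{2^i} χ(ξ_i) = 0` for `n ≥ 1`. -/
def chi : ℕ → DualSteenrod
  | 0 => 1
  | n + 1 => ∑ i : Fin (n + 1), xi (n + 1 - i) ^ 2 ^ (i : ℕ) * chi i

/-- Auxiliary: the left convolution inverse, on generators. -/
def chiLeft : ℕ → DualSteenrod
  | 0 => 1
  | n + 1 => ∑ i : Fin (n + 1), chiLeft i ^ 2 ^ (n + 1 - i) * xi (n + 1 - i)

def antipodeHom : DualSteenrod →ₐ[ZMod 2] DualSteenrod := evalHom chi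

theorem antipodeHom_xi (n : ℕ) : antipodeHom (xi n) = chi n :=
  evalHom_xi _ (by rw [chi]) n

theorem add_self_eq_zero (x : DualSteenrod) : x + x = 0 := by
  have h : (2 : ZMod 2) • x = 0 := by
    rw [show (2 : ZMod 2) = 0 from rfl, zero_smul]
  rwa [two_smul] at h

theorem sum_chi (n : ℕ) :
    ∑ p ∈ Finset.HasAntidiagonal.antidiagonal n, xi p.1 ^ 2 ^ p.2 * chi p.2 =
      if n = 0 then 1 else 0 := by
  cases n with
  | zero => simp [chi]
  | succ n =>
    rw [← Finset.Nat.sum_antidiagonal_swap, Finset.Nat.sum_antidiagonal_eq_sum_range_succ_mk,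
      Finset.sum_range_succ, ← Fin.sum_univ_eq_sum_range
        (fun k => xi (k, n + 1 - k).swap.1 ^ 2 ^ (k, n + 1 - k).swap.2 *
          chi (k, n + 1 - k).swap.2)]
    simp only [Prod.fst_swap, Prod.snd_swap, Nat.sub_self, xi_zero, one_pow, one_mul]
    have h : chi (n + 1) = ∑ i : Fin (n + 1), xi (n + 1 - i) ^ 2 ^ (i : ℕ) * chi i := by rw [chi]
    rw [← h, add_self_eq_zero, if_neg (Nat.succ_ne_zero n)]

theorem sum_chiLeft (n : ℕ) :
    ∑ p ∈ Finset.HasAntidiagonal.antidiagonal n, chiLeft p.1 ^ 2 ^ p.2 * xi p.2 =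
      if n = 0 then 1 else 0 := by
  cases n with
  | zero => simp [chiLeft]
  | succ n =>
    rw [Finset.Nat.sum_antidiagonal_eq_sum_range_succ_mk,
      Finset.sum_range_succ, ← Fin.sum_univ_eq_sum_range
        (fun k => chiLeft (k, n + 1 - k).1 ^ 2 ^ (k, n + 1 - k).2 * xi (k, n + 1 - k).2)]
    simp only [Nat.sub_self, xi_zero, mul_one, pow_zero, pow_one]
    have h : chiLeft (n + 1) =
      ∑ i : Fin (n + 1), chiLeft i ^ 2 ^ (n + 1 - i) * xi (n + 1 - i) := by rw [chiLeft]
    rw [← h, add_self_eq_zero, if_neg (Nat.succ_ne_zero n)]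

open WithConv in
theorem antipodeHom_mul : toConv (AlgHom.id (ZMod 2) DualSteenrod) * toConv antipodeHom = 1 := by
  apply WithConv.ofConv_injective
  apply hom_ext
  intro n
  change (toConv (AlgHom.id (ZMod 2) DualSteenrod) * toConv antipodeHom) (xi n) =
    (1 : WithConv (DualSteenrod →ₐ[ZMod 2] DualSteenrod)) (xi n)
  rw [AlgHom.convMul_apply, AlgHom.convOne_apply, comul_xi, counit_xi, map_sum]
  simp only [Algebra.TensorProduct.lift_tmul, AlgHom.id_apply, antipodeHom_xi]
  rw [sum_chi]
  split_ifs <;> simp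

open WithConv in
theorem chiLeft_mul : toConv (evalHom chiLeft) * toConv (AlgHom.id (ZMod 2) DualSteenrod) = 1 := by
  apply WithConv.ofConv_injective
  apply hom_ext
  intro n
  change (toConv (evalHom chiLeft) * toConv (AlgHom.id (ZMod 2) DualSteenrod)) (xi n) =
    (1 : WithConv (DualSteenrod →ₐ[ZMod 2] DualSteenrod)) (xi n)
  rw [AlgHom.convMul_apply, AlgHom.convOne_apply, comul_xi, counit_xi, map_sum]
  simp only [Algebra.TensorProduct.lift_tmul, AlgHom.id_apply, map_pow,
    evalHom_xi chiLeft (by rw [chiLeft])]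
  rw [sum_chiLeft]
  split_ifs <;> simp

open WithConv in
theorem mul_antipodeHom : toConv antipodeHom * toConv (AlgHom.id (ZMod 2) DualSteenrod) = 1 := by
  rw [← left_inv_eq_right_inv chiLeft_mul antipodeHom_mul]
  exact chiLeft_mul

/-- The Hopf algebra structure of the dual Steenrod algebra. -/
instance : HopfAlgebra (ZMod 2) DualSteenrod where
  antipode := antipodeHom.toLinearMap
  mul_antipode_rTensor_comul := by
    have h := congrArg (fun f => (WithConv.ofConv f).toLinearMap) mul_antipodeHom
    ext x
    have h2 := LinearMap.congr_fun h x
    exact h2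
  mul_antipode_lTensor_comul := by
    have h := congrArg (fun f => (WithConv.ofConv f).toLinearMap) antipodeHom_mul
    ext x
    have h2 := LinearMap.congr_fun h x
    exact h2

theorem antipode_xi (n : ℕ) : HopfAlgebra.antipode (ZMod 2) (xi n) = chi n := antipodeHom_xi n

end DualSteenrod

/-- The ideal `(ξ_1, …, ξ_{m-1}, ξ_m^{2^m}, ξ_{m+1}^{2^m}, …)` of the dual Steenrod algebra. -/
def elementaryIdeal (m : ℕ) : Ideal DualSteenrod :=
  Ideal.span ({x | ∃ t, 0 < t ∧ t < m ∧ x = DualSteenrod.xi t} ∪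
    {x | ∃ t, 0 < t ∧ m ≤ t ∧ x = DualSteenrod.xi t ^ 2 ^ m})

namespace elementaryIdeal

open DualSteenrod

theorem xi_mem {m t : ℕ} (h0 : 0 < t) (h : t < m) : xi t ∈ elementaryIdeal m :=
  Ideal.subset_span (Or.inl ⟨t, h0, h, rfl⟩)

theorem xi_pow_mem {m t : ℕ} (h0 : 0 < t) : xi t ^ 2 ^ m ∈ elementaryIdeal m := by
  rcases lt_or_ge t m with h | h
  · exact Ideal.pow_mem_of_mem _ (xi_mem h0 h) _ (by positivity)
  · exact Ideal.subset_span (Or.inr ⟨t, h0, h, rfl⟩)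

theorem chi_mem {m t : ℕ} (h0 : 0 < t) (h : t < m) : chi t ∈ elementaryIdeal m := by
  obtain ⟨t, rfl⟩ := Nat.exists_eq_succ_of_ne_zero h0.ne'
  rw [Nat.succ_eq_add_one, chi]
  refine Ideal.sum_mem _ fun i _ => Ideal.mul_mem_right _ _ ?_
  exact Ideal.pow_mem_of_mem _ (xi_mem (by omega) (by omega)) _ (by positivity)

theorem chi_pow_mem {m t : ℕ} (h0 : 0 < t) : chi t ^ 2 ^ m ∈ elementaryIdeal m := by
  obtain ⟨t, rfl⟩ := Nat.exists_eq_succ_of_ne_zero h0.ne'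
  rw [Nat.succ_eq_add_one, chi, sum_pow_two_pow]
  refine Ideal.sum_mem _ fun i _ => ?_
  rw [mul_pow, ← pow_mul, mul_comm (2 ^ (i : ℕ)), pow_mul]
  exact Ideal.mul_mem_right _ _
    (Ideal.pow_mem_of_mem _ (xi_pow_mem (by omega)) _ (by positivity))

theorem comul_mem {m : ℕ} {x : DualSteenrod} (hx : x ∈ elementaryIdeal m) :
    Algebra.TensorProduct.map (Ideal.Quotient.mkₐ (ZMod 2) (elementaryIdeal m))
      (Ideal.Quotient.mkₐ (ZMod 2) (elementaryIdeal m))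
      (Bialgebra.comulAlgHom (ZMod 2) DualSteenrod x) = 0 := by
  set g := (Algebra.TensorProduct.map (Ideal.Quotient.mkₐ (ZMod 2) (elementaryIdeal m))
      (Ideal.Quotient.mkₐ (ZMod 2) (elementaryIdeal m))).comp
      (Bialgebra.comulAlgHom (ZMod 2) DualSteenrod) with hg
  have hmk : ∀ {y : DualSteenrod}, y ∈ elementaryIdeal m →
      Ideal.Quotient.mkₐ (ZMod 2) (elementaryIdeal m) y = 0 := fun hy =>
    Ideal.Quotient.eq_zero_iff_mem.2 hy
  have hxi : ∀ t, g (xi t) = ∑ p ∈ Finset.HasAntidiagonal.antidiagonal t,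
      (Ideal.Quotient.mkₐ (ZMod 2) (elementaryIdeal m) (xi p.1) ^ 2 ^ p.2) ⊗ₜ[ZMod 2]
        Ideal.Quotient.mkₐ (ZMod 2) (elementaryIdeal m) (xi p.2) := by
    intro t
    rw [hg, AlgHom.comp_apply, Bialgebra.comulAlgHom_apply, comul_xi, map_sum]
    simp only [Algebra.TensorProduct.map_tmul, map_pow]
  suffices h : elementaryIdeal m ≤ RingHom.ker g from h hx
  refine Ideal.span_le.2 ?_
  rintro _ (⟨t, h0, h, rfl⟩ | ⟨t, h0, h, rfl⟩)
  · change g _ = 0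
    rw [hxi]
    refine Finset.sum_eq_zero ?_
    rintro ⟨a, i⟩ hp
    rw [Finset.HasAntidiagonal.mem_antidiagonal] at hp
    change a + i = t at hp
    rcases Nat.eq_zero_or_pos i with rfl | hi
    · rw [hmk (xi_mem (t := a) (by omega) (by omega))]
      simp
    · rw [hmk (xi_mem (t := i) hi (by omega))]
      simp
  · change g _ = 0
    rw [map_pow, hxi, sum_pow_two_pow]
    refine Finset.sum_eq_zero ?_
    rintro ⟨a, i⟩ hp
    rw [Finset.HasAntidiagonal.mem_antidiagonal] at hp
    change a + i = t at hp
    rw [Algebra.TensorProduct.tmul_pow]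
    rcases Nat.eq_zero_or_pos i with rfl | hi
    · simp only [pow_zero, pow_one]
      rw [← map_pow, hmk (xi_pow_mem (t := a) (by omega))]
      simp
    · rw [← map_pow _ (xi i), hmk (xi_pow_mem hi)]
      simp

instance (m : ℕ) : (elementaryIdeal m).IsHopfIdeal (ZMod 2) where
  counit_eq_zero x hx := by
    suffices h : elementaryIdeal m ≤ RingHom.ker (Bialgebra.counitAlgHom (ZMod 2) DualSteenrod)
      from h hx
    refine Ideal.span_le.2 ?_
    rintro _ (⟨t, h0, h, rfl⟩ | ⟨t, h0, h, rfl⟩)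
    · change Coalgebra.counit (R := ZMod 2) (xi t) = 0
      rw [counit_xi, if_neg h0.ne']
    · change Bialgebra.counitAlgHom (ZMod 2) DualSteenrod (xi t ^ 2 ^ m) = 0
      rw [map_pow, Bialgebra.counitAlgHom_apply, counit_xi, if_neg h0.ne', zero_pow (by positivity)]
  map_mkQ_comul_eq_zero x hx := comul_mem hx
  antipode_mem x hx := by
    suffices h : elementaryIdeal m ≤ (elementaryIdeal m).comap
      (HopfAlgebra.antipodeAlgHom (ZMod 2) DualSteenrod) from h hx
    refine Ideal.span_le.2 ?_
    rintro _ (⟨t, h0, h, rfl⟩ | ⟨t, h0, h, rfl⟩)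
    · change HopfAlgebra.antipode (ZMod 2) (xi t) ∈ elementaryIdeal m
      rw [antipode_xi]
      exact chi_mem h0 h
    · change HopfAlgebra.antipodeAlgHom (ZMod 2) DualSteenrod (xi t ^ 2 ^ m) ∈ elementaryIdeal m
      rw [map_pow]
      change HopfAlgebra.antipode (ZMod 2) (xi t) ^ 2 ^ m ∈ elementaryIdeal m
      rw [antipode_xi]
      exact chi_pow_mem h0

end elementaryIdeal

/-- The dual Hopf algebra `E(m)^* = A_* / (ξ_1, …, ξ_{m-1}, ξ_m^{2^m}, ξ_{m+1}^{2^m}, …)` of the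
maximal elementary sub-Hopf algebra `E(m)` of the Steenrod algebra. -/
abbrev ElementaryDual (m : ℕ) : Type := DualSteenrod ⧸ elementaryIdeal m

/-- The restriction `A_* → E(m)^*`, dual to the inclusion of `E(m)` in the Steenrod algebra. -/
def ElementaryDual.proj (m : ℕ) : DualSteenrod →ₐc[ZMod 2] ElementaryDual m :=
  Bialgebra.Quotient.mkBialgHom (elementaryIdeal m)


namespace HopfBar

open HopfAlgebra

variable (B : Type*) [CommRing B] [HopfAlgebra (ZMod 2) B]

/-- The linear dual of the augmentation ideal of the Hopf algebra dual to `B`: functionals on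
the whole Hopf algebra modulo the augmentation, that is, `B` modulo its unit. -/
abbrev Reduced : Type _ := B ⧸ (Submodule.span (ZMod 2) {(1 : B)})

/-- The quotient map `B → Reduced B`, dual to the inclusion of the augmentation ideal. -/
def toReduced : B →ₗ[ZMod 2] Reduced B := Submodule.mkQ _

theorem toReduced_one : toReduced B 1 = 0 :=
  (Submodule.Quotient.mk_eq_zero _).2 (Submodule.mem_span_singleton_self 1)

/-- The coaction `a ↦ ∑ a' ⊗ a''` on `Reduced B`. -/
def reducedCoaction : Reduced B →ₗ[ZMod 2] B ⊗[ZMod 2] Reduced B :=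
  Submodule.liftQ _ ((toReduced B).lTensor B ∘ₗ Coalgebra.comul) <| by
    rw [Submodule.span_singleton_le_iff_mem, LinearMap.mem_ker, LinearMap.comp_apply,
      Bialgebra.comul_one, Algebra.TensorProduct.one_def, LinearMap.lTensor_tmul, toReduced_one,
      TensorProduct.tmul_zero]

theorem reducedCoaction_toReduced (b : B) : reducedCoaction B (toReduced B b) =
    (toReduced B).lTensor B (Coalgebra.comul b) := rfl

/-- The underlying algebra of the cochain complex: the direct sum over `k` of the `k`-fold tensor
powers of `Reduced B`, with product `(a_1|⋯|a_k)(b_1|⋯|b_l) = a_1|⋯|a_k|b_1|⋯|b_l`. -/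
abbrev Cochain : Type _ := TensorAlgebra (ZMod 2) (Reduced B)

/-- The one-fold tensor `[b]`. -/
def bar : B →ₗ[ZMod 2] Cochain B := TensorAlgebra.ι (ZMod 2) ∘ₗ toReduced B

/-- The diagonal coaction
`a_1|⋯|a_k ↦ ∑ a_1'⋯a_k' ⊗ (a_1''|⋯|a_k'')`. -/
def coaction : Cochain B →ₐ[ZMod 2] B ⊗[ZMod 2] Cochain B :=
  TensorAlgebra.lift (ZMod 2) ((TensorAlgebra.ι (ZMod 2)).lTensor B ∘ₗ reducedCoaction B)

/-- `b ⊗ (a_1|⋯|a_k) ↦ b|a_1|⋯|a_k`. -/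
def cons : B ⊗[ZMod 2] Cochain B →ₗ[ZMod 2] Cochain B :=
  LinearMap.mul' (ZMod 2) (Cochain B) ∘ₗ (bar B).rTensor (Cochain B)

/-- The differential
`∂(a_1|⋯|a_k) = ∑ χ(a_1'⋯a_k')|a_1''|⋯|a_k''`, with `χ` the antipode. -/
def d : Cochain B →ₗ[ZMod 2] Cochain B :=
  cons B ∘ₗ (antipode (ZMod 2)).rTensor (Cochain B) ∘ₗ (coaction B).toLinearMap

section Proofs

variable {B}

theorem cons_tmul (b : B) (t : Cochain B) : cons B (b ⊗ₜ t) = bar B b * t := rfl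

theorem bar_one : bar B 1 = 0 := by
  rw [bar, LinearMap.comp_apply, toReduced_one, map_zero]

theorem coaction_bar (b : B) : coaction B (bar B b) = (bar B).lTensor B (Coalgebra.comul b) := by
  rw [coaction, bar, LinearMap.comp_apply, TensorAlgebra.lift_ι_apply, LinearMap.comp_apply,
    reducedCoaction_toReduced, ← LinearMap.comp_apply, ← LinearMap.lTensor_comp]

theorem cochain_hom_ext {R : Type*} [Semiring R] [Algebra (ZMod 2) R]
    {f g : Cochain B →ₐ[ZMod 2] R} (h : ∀ b, f (bar B b) = g (bar B b)) : f = g := by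
  refine TensorAlgebra.hom_ext (LinearMap.ext fun v => ?_)
  obtain ⟨b, rfl⟩ := Submodule.mkQ_surjective _ v
  exact h b

variable (B) in
/-- `t ↦ ∑ χ(t') ⊗ t''` as an algebra homomorphism. -/
def twist : Cochain B →ₐ[ZMod 2] B ⊗[ZMod 2] Cochain B :=
  (Algebra.TensorProduct.map (antipodeAlgHom (ZMod 2) B) (AlgHom.id (ZMod 2) (Cochain B))).comp
    (coaction B)

theorem d_apply (t : Cochain B) : d B t = cons B (twist B t) := rfl

variable (B) in
/-- `b ⊗ 1 ↦ b' ⊗ b'' ⊗ 1`. -/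
def left3 : B ⊗[ZMod 2] B →ₐ[ZMod 2] B ⊗[ZMod 2] (B ⊗[ZMod 2] Cochain B) :=
  Algebra.TensorProduct.map (AlgHom.id (ZMod 2) B) Algebra.TensorProduct.includeLeft

variable (B) in
def right3 : B ⊗[ZMod 2] Cochain B →ₐ[ZMod 2] B ⊗[ZMod 2] (B ⊗[ZMod 2] Cochain B) :=
  Algebra.TensorProduct.map (AlgHom.id (ZMod 2) B) Algebra.TensorProduct.includeRight

theorem left3_mul_right3_comm (x : B ⊗[ZMod 2] B) (y : B ⊗[ZMod 2] Cochain B) :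
    Commute (left3 B x) (right3 B y) := by
  induction x using TensorProduct.induction_on with
  | zero => rw [map_zero]; exact Commute.zero_left _
  | add x x' hx hx' => rw [map_add]; exact hx.add_left hx'
  | tmul a b =>
    induction y using TensorProduct.induction_on with
    | zero => rw [map_zero]; exact Commute.zero_right _
    | add y y' hy hy' => rw [map_add]; exact hy.add_right hy'
    | tmul c t =>
      simp [left3, right3, Commute, SemiconjBy, mul_comm]

variable (B) in
/-- The diagonal coaction on `B ⊗ Cochain B`. -/
def coaction3 : B ⊗[ZMod 2] Cochain B →ₐ[ZMod 2] B ⊗[ZMod 2] (B ⊗[ZMod 2] Cochain B) :=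
  Algebra.TensorProduct.lift ((left3 B).comp (Bialgebra.comulAlgHom (ZMod 2) B))
    ((right3 B).comp (coaction B)) fun _ _ => left3_mul_right3_comm _ _

theorem coaction3_tmul (b : B) (t : Cochain B) : coaction3 B (b ⊗ₜ t) =
    left3 B (Coalgebra.comul b) * right3 B (coaction B t) := rfl

theorem coaction_cons_aux (x : B ⊗[ZMod 2] B) (y : B ⊗[ZMod 2] Cochain B) :
    (bar B).lTensor B x * y = (cons B).lTensor B (left3 B x * right3 B y) := by
  induction x using TensorProduct.induction_on with
  | zero => simp
  | add x x' hx hx' => simp only [map_add, add_mul, hx, hx']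
  | tmul a b =>
    induction y using TensorProduct.induction_on with
    | zero => simp
    | add y y' hy hy' => simp only [map_add, mul_add, hy, hy']
    | tmul c t => simp [left3, right3, cons_tmul]

theorem coaction_cons (x : B ⊗[ZMod 2] Cochain B) :
    coaction B (cons B x) = (cons B).lTensor B (coaction3 B x) := by
  induction x using TensorProduct.induction_on with
  | zero => simp
  | add x y hx hy => simp only [map_add, hx, hy]
  | tmul b t => rw [cons_tmul, map_mul, coaction_bar, coaction3_tmul, coaction_cons_aux]

open WithConv in
/-- `∑ (Δ χ(b')) (b'' ⊗ 1) = 1 ⊗ χ(b)`. -/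
theorem conv_aux :
    toConv ((Bialgebra.comulAlgHom (ZMod 2) B).comp (antipodeAlgHom (ZMod 2) B)) *
      toConv (Algebra.TensorProduct.includeLeft : B →ₐ[ZMod 2] B ⊗[ZMod 2] B) =
    toConv ((Algebra.TensorProduct.includeRight : B →ₐ[ZMod 2] B ⊗[ZMod 2] B).comp
      (antipodeAlgHom (ZMod 2) B)) := by
  have h : toConv (Bialgebra.comulAlgHom (ZMod 2) B) =
      toConv (Algebra.TensorProduct.includeLeft : B →ₐ[ZMod 2] B ⊗[ZMod 2] B) *
        toConv (Algebra.TensorProduct.includeRight : B →ₐ[ZMod 2] B ⊗[ZMod 2] B) := by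
    apply WithConv.ofConv_injective
    ext b
    change Coalgebra.comul b = (toConv _ * toConv _ : WithConv (B →ₐ[ZMod 2] _)) b
    rw [AlgHom.convMul_apply]
    generalize (Coalgebra.comul b : B ⊗[ZMod 2] B) = x
    induction x using TensorProduct.induction_on with
    | zero => simp
    | add x y hx hy => rw [map_add, ← hx, ← hy]
    | tmul a b => simp
  have h1 : toConv ((Bialgebra.comulAlgHom (ZMod 2) B).comp (antipodeAlgHom (ZMod 2) B)) =
      (toConv (Bialgebra.comulAlgHom (ZMod 2) B))⁻¹ := rfl
  have h2 : toConv ((Algebra.TensorProduct.includeRight : B →ₐ[ZMod 2] B ⊗[ZMod 2] B).comp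
      (antipodeAlgHom (ZMod 2) B)) =
      (toConv (Algebra.TensorProduct.includeRight : B →ₐ[ZMod 2] B ⊗[ZMod 2] B))⁻¹ := rfl
  have key : ∀ {G : Type _} [Group G] (x y z : G), z = x * y → z⁻¹ * x = y⁻¹ := by
    intro G _ x y z hz
    rw [hz, mul_inv_rev, inv_mul_cancel_right]
  rw [h1, h2]
  refine key (G := WithConv (B →ₐ[ZMod 2] B ⊗[ZMod 2] B)) _ _ _ ?_
  exact h

open WithConv in
theorem antipode_antipode (b : B) : antipode (ZMod 2) (antipode (ZMod 2) b) = b := by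
  have h : (toConv (AlgHom.id (ZMod 2) B))⁻¹⁻¹ = toConv (AlgHom.id (ZMod 2) B) := inv_inv _
  exact DFunLike.congr_fun (congrArg WithConv.ofConv h) b

theorem coaction3_twist (t : Cochain B) : coaction3 B (twist B t) = 1 ⊗ₜ twist B t := by
  suffices h : (coaction3 B).comp (twist B) =
      (Algebra.TensorProduct.includeRight : B ⊗[ZMod 2] Cochain B →ₐ[ZMod 2] _).comp (twist B) from
    DFunLike.congr_fun h t
  refine cochain_hom_ext fun b => ?_
  let Φ : B ⊗[ZMod 2] (B ⊗[ZMod 2] B) →ₗ[ZMod 2] B ⊗[ZMod 2] (B ⊗[ZMod 2] Cochain B) :=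
    LinearMap.mul' (ZMod 2) _ ∘ₗ TensorProduct.map
      ((left3 B).toLinearMap ∘ₗ Coalgebra.comul ∘ₗ antipode (ZMod 2))
      ((right3 B).toLinearMap ∘ₗ (bar B).lTensor B)
  have tw : ∀ y : B ⊗[ZMod 2] B, Algebra.TensorProduct.map (antipodeAlgHom (ZMod 2) B)
      (AlgHom.id (ZMod 2) (Cochain B)) ((bar B).lTensor B y) =
      TensorProduct.map (antipode (ZMod 2)) (bar B) y := by
    intro y
    induction y using TensorProduct.induction_on with
    | zero => simp
    | add y z hy hz => simp only [map_add, hy, hz]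
    | tmul a c => simp
  have step1 : ∀ y : B ⊗[ZMod 2] B,
      coaction3 B (TensorProduct.map (antipode (ZMod 2)) (bar B) y) =
        Φ (Coalgebra.comul.lTensor B y) := by
    intro y
    induction y using TensorProduct.induction_on with
    | zero => simp
    | add y z hy hz => simp only [map_add, hy, hz]
    | tmul a c =>
      rw [TensorProduct.map_tmul, coaction3_tmul, coaction_bar]
      rfl
  have step2 : ∀ (s : B ⊗[ZMod 2] B) (z : B),
      Φ (TensorProduct.assoc (ZMod 2) B B B (s ⊗ₜ z)) =
        left3 B (Algebra.TensorProduct.lift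
          ((Bialgebra.comulAlgHom (ZMod 2) B).comp (antipodeAlgHom (ZMod 2) B))
          (Algebra.TensorProduct.includeLeft : B →ₐ[ZMod 2] B ⊗[ZMod 2] B)
          (fun _ _ => Commute.all _ _) s) * (1 ⊗ₜ (1 ⊗ₜ bar B z)) := by
    intro s z
    induction s using TensorProduct.induction_on with
    | zero => simp
    | add s s' hs hs' => simp only [map_add, add_mul, TensorProduct.add_tmul, hs, hs']
    | tmul a c =>
      change left3 B (Coalgebra.comul (antipode (ZMod 2) a)) * right3 B (c ⊗ₜ bar B z) = _
      rw [Algebra.TensorProduct.lift_tmul, map_mul, mul_assoc]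
      congr 1
      simp [left3, right3]
  have step3 : ∀ y : B ⊗[ZMod 2] B,
      Φ (TensorProduct.assoc (ZMod 2) B B B (Coalgebra.comul.rTensor B y)) =
        1 ⊗ₜ (TensorProduct.map (antipode (ZMod 2)) (bar B) y) := by
    intro y
    induction y using TensorProduct.induction_on with
    | zero => simp
    | add y z hy hz => simp only [map_add, hy, hz, TensorProduct.tmul_add]
    | tmul a c =>
      rw [LinearMap.rTensor_tmul, step2]
      have h := DFunLike.congr_fun (congrArg WithConv.ofConv (conv_aux (B := B))) a
      have h2 : Algebra.TensorProduct.lift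
          ((Bialgebra.comulAlgHom (ZMod 2) B).comp (antipodeAlgHom (ZMod 2) B))
          (Algebra.TensorProduct.includeLeft : B →ₐ[ZMod 2] B ⊗[ZMod 2] B)
          (fun _ _ => Commute.all _ _) (Coalgebra.comul a) = 1 ⊗ₜ antipode (ZMod 2) a := by
        refine Eq.trans ?_ h
        exact (AlgHom.convMul_apply _ _ _).symm
      rw [h2]
      simp [left3]
  change coaction3 B (twist B (bar B b)) = 1 ⊗ₜ twist B (bar B b)
  rw [twist, AlgHom.comp_apply, coaction_bar, tw, step1, ← Coalgebra.coassoc_apply, step3]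

theorem coaction_d (t : Cochain B) : coaction B (d B t) = 1 ⊗ₜ d B t := by
  rw [d_apply, coaction_cons, coaction3_twist, LinearMap.lTensor_tmul]

theorem cons_mul (x : B ⊗[ZMod 2] Cochain B) (t : Cochain B) :
    cons B (x * 1 ⊗ₜ t) = cons B x * t := by
  induction x using TensorProduct.induction_on with
  | zero => simp
  | add x y hx hy => simp only [map_add, add_mul, hx, hy]
  | tmul b s => simp [cons_tmul, mul_assoc]

theorem twist_of_coaction {z : Cochain B} (h : coaction B z = 1 ⊗ₜ z) : twist B z = 1 ⊗ₜ z := by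
  rw [twist, AlgHom.comp_apply, h]
  simp

theorem counit_coaction (t : Cochain B) :
    (Coalgebra.counit (R := ZMod 2) (A := B)).rTensor (Cochain B) (coaction B t) = 1 ⊗ₜ t := by
  suffices h : (Algebra.TensorProduct.map (Bialgebra.counitAlgHom (ZMod 2) B)
      (AlgHom.id (ZMod 2) (Cochain B))).comp (coaction B) =
      Algebra.TensorProduct.includeRight from DFunLike.congr_fun h t
  refine cochain_hom_ext fun b => ?_
  have h : ∀ y : B ⊗[ZMod 2] B, Algebra.TensorProduct.map (Bialgebra.counitAlgHom (ZMod 2) B)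
      (AlgHom.id (ZMod 2) (Cochain B)) ((bar B).lTensor B y) =
      (bar B).lTensor (ZMod 2) ((Coalgebra.counit (R := ZMod 2) (A := B)).rTensor B y) := by
    intro y
    induction y using TensorProduct.induction_on with
    | zero => simp
    | add y z hy hz => simp only [map_add, hy, hz]
    | tmul a c => simp
  rw [AlgHom.comp_apply, coaction_bar, h, Coalgebra.rTensor_counit_comul]
  simp

variable (B) in
/-- The section of `toReduced` with values in the kernel of the counit. -/
def reducedSection : Reduced B →ₗ[ZMod 2] B :=
  Submodule.liftQ _ (LinearMap.id - Algebra.linearMap (ZMod 2) B ∘ₗ Coalgebra.counit) <| by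
    rw [Submodule.span_singleton_le_iff_mem, LinearMap.mem_ker]
    simp

theorem reducedSection_toReduced (b : B) : reducedSection B (toReduced B b) =
    b - algebraMap (ZMod 2) B (Coalgebra.counit b) := rfl

theorem toReduced_reducedSection (v : Reduced B) : toReduced B (reducedSection B v) = v := by
  obtain ⟨b, rfl⟩ := Submodule.mkQ_surjective _ v
  change toReduced B (reducedSection B (toReduced B b)) = toReduced B b
  rw [reducedSection_toReduced, map_sub, Algebra.algebraMap_eq_smul_one, map_smul, toReduced_one,
    smul_zero, sub_zero]

variable (B) in
/-- `v ⊗ (a_1|⋯|a_k) ↦ v|a_1|⋯|a_k`. -/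
def consR : Reduced B ⊗[ZMod 2] Cochain B →ₗ[ZMod 2] Cochain B :=
  LinearMap.mul' (ZMod 2) (Cochain B) ∘ₗ (TensorAlgebra.ι (ZMod 2)).rTensor (Cochain B)

theorem cons_eq (x : B ⊗[ZMod 2] Cochain B) :
    cons B x = consR B ((toReduced B).rTensor (Cochain B) x) := by
  induction x using TensorProduct.induction_on with
  | zero => simp
  | add x y hx hy => simp only [map_add, hx, hy]
  | tmul b s => rfl

variable (B) in
def unconsAux : (ZMod 2 × Reduced B ⊗[ZMod 2] Cochain B) →ₗ[ZMod 2] Cochain B :=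
  LinearMap.coprod (Algebra.linearMap (ZMod 2) (Cochain B)) (consR B)

variable (B) in
/-- Left multiplication by generators on `F_2 ⊕ (Reduced B ⊗ Cochain B)`. -/
def unconsHom : Cochain B →ₐ[ZMod 2] Module.End (ZMod 2) (ZMod 2 × Reduced B ⊗[ZMod 2] Cochain B) :=
  TensorAlgebra.lift (ZMod 2) <| LinearMap.mk₂ (ZMod 2)
    (fun v x => ((0 : ZMod 2), v ⊗ₜ[ZMod 2] unconsAux B x))
    (fun v w x => by simp [TensorProduct.add_tmul]) (fun r v x => by simp [TensorProduct.smul_tmul'])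
    (fun v x y => by simp [TensorProduct.tmul_add]) (fun r v x => by simp)

variable (B) in
/-- The decomposition of a cochain into its scalar part and the rest. -/
def uncons : Cochain B →ₗ[ZMod 2] ZMod 2 × Reduced B ⊗[ZMod 2] Cochain B :=
  LinearMap.applyₗ (1, 0) ∘ₗ (unconsHom B).toLinearMap

theorem uncons_ι_mul (v : Reduced B) (t : Cochain B) :
    uncons B (TensorAlgebra.ι (ZMod 2) v * t) = (0, v ⊗ₜ unconsAux B (uncons B t)) := by
  change unconsHom B (TensorAlgebra.ι (ZMod 2) v * t) (1, 0) = _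
  rw [map_mul, Module.End.mul_apply, unconsHom, TensorAlgebra.lift_ι_apply]
  rfl

theorem unconsAux_unconsHom (t : Cochain B) (x : ZMod 2 × Reduced B ⊗[ZMod 2] Cochain B) :
    unconsAux B (unconsHom B t x) = t * unconsAux B x := by
  induction t using TensorAlgebra.induction generalizing x with
  | algebraMap r =>
    simp [Algebra.algebraMap_eq_smul_one]
  | ι v => simp [unconsHom, unconsAux, consR]
  | mul a b ha hb => rw [map_mul, Module.End.mul_apply, ha, hb, mul_assoc]
  | add a b ha hb => rw [map_add, LinearMap.add_apply, map_add, ha, hb, add_mul]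

theorem unconsAux_uncons (t : Cochain B) : unconsAux B (uncons B t) = t := by
  have h := unconsAux_unconsHom t (1, 0)
  rw [show unconsAux B (1, 0) = 1 by simp [unconsAux], mul_one] at h
  exact h

theorem uncons_consR (x : Reduced B ⊗[ZMod 2] Cochain B) : (uncons B (consR B x)).2 = x := by
  induction x using TensorProduct.induction_on with
  | zero => simp
  | add x y hx hy => simp only [map_add, Prod.snd_add, hx, hy]
  | tmul v t =>
    change (uncons B (TensorAlgebra.ι (ZMod 2) v * t)).2 = _
    rw [uncons_ι_mul, unconsAux_uncons]

theorem consR_injective : Function.Injective (consR B) := fun x y h => by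
  rw [← uncons_consR x, h, uncons_consR]

/-- A cochain is a cocycle if and only if it is primitive for the diagonal coaction. -/
theorem d_eq_zero_iff (z : Cochain B) : d B z = 0 ↔ coaction B z = 1 ⊗ₜ z := by
  constructor
  · intro h
    rw [d_apply, cons_eq, ← map_zero (consR B)] at h
    have h1 := consR_injective h
    have h2 : ∀ x : B ⊗[ZMod 2] Cochain B,
        (reducedSection B).rTensor (Cochain B) ((toReduced B).rTensor (Cochain B) x) =
        x - (Algebra.linearMap (ZMod 2) B ∘ₗ Coalgebra.counit).rTensor (Cochain B) x := by
      intro x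
      rw [← LinearMap.comp_apply, ← LinearMap.rTensor_comp]
      have : reducedSection B ∘ₗ toReduced B =
        LinearMap.id - Algebra.linearMap (ZMod 2) B ∘ₗ Coalgebra.counit := rfl
      rw [this, LinearMap.rTensor_sub, LinearMap.sub_apply, LinearMap.rTensor_id,
        LinearMap.id_apply]
    have h3 := h2 (twist B z)
    rw [h1, map_zero] at h3
    have h4 : ∀ x : B ⊗[ZMod 2] Cochain B,
        (Algebra.linearMap (ZMod 2) B ∘ₗ Coalgebra.counit).rTensor (Cochain B)
          (Algebra.TensorProduct.map (antipodeAlgHom (ZMod 2) B)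
            (AlgHom.id (ZMod 2) (Cochain B)) x) =
        (Algebra.linearMap (ZMod 2) B).rTensor (Cochain B)
          ((Coalgebra.counit (R := ZMod 2) (A := B)).rTensor (Cochain B) x) := by
      intro x
      induction x using TensorProduct.induction_on with
      | zero => simp
      | add x y hx hy => simp only [map_add, hx, hy]
      | tmul b s => simp
    have h5 : twist B z = 1 ⊗ₜ z := by
      rw [eq_comm, sub_eq_zero] at h3
      rw [h3, twist, AlgHom.comp_apply, h4, counit_coaction]
      simp
    have h6 : ∀ x : B ⊗[ZMod 2] Cochain B,
        (antipode (ZMod 2) (A := B)).rTensor (Cochain B)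
          (Algebra.TensorProduct.map (antipodeAlgHom (ZMod 2) B)
            (AlgHom.id (ZMod 2) (Cochain B)) x) = x := by
      intro x
      induction x using TensorProduct.induction_on with
      | zero => simp
      | add x y hx hy => simp only [map_add, hx, hy]
      | tmul b s => simp [antipode_antipode]
    rw [← h6 (coaction B z), ← AlgHom.comp_apply, ← twist, h5]
    simp
  · intro h
    rw [d_apply, twist_of_coaction h, cons_tmul, bar_one, zero_mul]

theorem d_mul {z : Cochain B} (hz : d B z = 0) (c : Cochain B) : d B (c * z) = d B c * z := by
  rw [d_apply, map_mul, twist_of_coaction ((d_eq_zero_iff z).1 hz), cons_mul, ← d_apply]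

theorem d_d (c : Cochain B) : d B (d B c) = 0 := (d_eq_zero_iff _).2 (coaction_d c)

variable (B) in
/-- The diagonal coaction on `Reduced B ⊗ Cochain B`. -/
def coactionR : Reduced B ⊗[ZMod 2] Cochain B →ₗ[ZMod 2]
    B ⊗[ZMod 2] (Reduced B ⊗[ZMod 2] Cochain B) :=
  (LinearMap.mul' (ZMod 2) B).rTensor _ ∘ₗ
    (TensorProduct.tensorTensorTensorComm (ZMod 2) B (Reduced B) B (Cochain B)).toLinearMap ∘ₗ
      TensorProduct.map (reducedCoaction B) (coaction B).toLinearMap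

theorem coaction_consR (x : Reduced B ⊗[ZMod 2] Cochain B) :
    coaction B (consR B x) = (consR B).lTensor B (coactionR B x) := by
  induction x using TensorProduct.induction_on with
  | zero => simp
  | add x y hx hy => simp only [map_add, hx, hy]
  | tmul v t =>
    have h1 : coaction B (consR B (v ⊗ₜ t)) =
        (TensorAlgebra.ι (ZMod 2)).lTensor B (reducedCoaction B v) * coaction B t := by
      change coaction B (TensorAlgebra.ι (ZMod 2) v * t) = _
      rw [map_mul]
      congr 1
      rw [coaction, TensorAlgebra.lift_ι_apply]
      rfl
    have h2 : ∀ (p : B ⊗[ZMod 2] Reduced B) (q : B ⊗[ZMod 2] Cochain B),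
        (TensorAlgebra.ι (ZMod 2)).lTensor B p * q = (consR B).lTensor B
          ((LinearMap.mul' (ZMod 2) B).rTensor _
            (TensorProduct.tensorTensorTensorComm (ZMod 2) B (Reduced B) B (Cochain B)
              (p ⊗ₜ q))) := by
      intro p q
      induction p using TensorProduct.induction_on with
      | zero => simp
      | add p p' hp hp' => simp only [map_add, add_mul, TensorProduct.add_tmul, hp, hp']
      | tmul a w =>
        induction q using TensorProduct.induction_on with
        | zero => simp
        | add q q' hq hq' => simp only [map_add, mul_add, TensorProduct.tmul_add, hq, hq']
        | tmul c s => simp [consR]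
    rw [h1, h2]
    rfl

theorem comul_section (v : Reduced B) : Coalgebra.comul (reducedSection B v) =
    (reducedSection B).lTensor B (reducedCoaction B v) + reducedSection B v ⊗ₜ[ZMod 2] 1 := by
  obtain ⟨b, rfl⟩ := Submodule.mkQ_surjective _ v
  change Coalgebra.comul (reducedSection B (toReduced B b)) =
    (reducedSection B).lTensor B (reducedCoaction B (toReduced B b)) +
      reducedSection B (toReduced B b) ⊗ₜ[ZMod 2] 1
  have h : reducedSection B ∘ₗ toReduced B =
    LinearMap.id - Algebra.linearMap (ZMod 2) B ∘ₗ Coalgebra.counit := rfl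
  rw [reducedCoaction_toReduced, ← LinearMap.comp_apply (LinearMap.lTensor B (reducedSection B)),
    ← LinearMap.lTensor_comp, h, LinearMap.lTensor_sub, LinearMap.sub_apply,
    LinearMap.lTensor_id, LinearMap.id_apply, LinearMap.lTensor_comp, LinearMap.comp_apply,
    Coalgebra.lTensor_counit_comul, reducedSection_toReduced, map_sub, LinearMap.lTensor_tmul,
    Algebra.algebraMap_eq_smul_one, map_smul, Bialgebra.comul_one, TensorProduct.sub_tmul,
    Algebra.TensorProduct.one_def, TensorProduct.smul_tmul']
  simp

theorem counit_section (v : Reduced B) : Coalgebra.counit (R := ZMod 2) (reducedSection B v) = 0 := by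
  obtain ⟨b, rfl⟩ := Submodule.mkQ_surjective _ v
  change Coalgebra.counit (R := ZMod 2) (reducedSection B (toReduced B b)) = 0
  rw [reducedSection_toReduced]
  simp

theorem mul_section (v : Reduced B) :
    LinearMap.mul' (ZMod 2) B (TensorProduct.map (antipode (ZMod 2)) (reducedSection B)
      (reducedCoaction B v)) = - antipode (ZMod 2) (reducedSection B v) := by
  have h := mul_antipode_rTensor_comul_apply (R := ZMod 2) (reducedSection B v)
  rw [counit_section, map_zero, comul_section, map_add, map_add, LinearMap.rTensor_tmul,
    LinearMap.mul'_apply, mul_one, ← LinearMap.comp_apply (LinearMap.rTensor B _),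
    LinearMap.rTensor_comp_lTensor] at h
  exact eq_neg_of_add_eq_zero_left h

variable (B) in
/-- `v ⊗ t ↦ (s(v) ⊗ 1) · coaction t`. -/
def shear : Reduced B ⊗[ZMod 2] Cochain B →ₗ[ZMod 2] B ⊗[ZMod 2] Cochain B :=
  LinearMap.mul' (ZMod 2) _ ∘ₗ
    TensorProduct.map ((TensorProduct.mk (ZMod 2) B (Cochain B)).flip 1 ∘ₗ reducedSection B)
      (coaction B).toLinearMap

/-- `v ⊗ t ↦ t|s(v)χ(c')|c''`. -/
def insertCochain (c : Cochain B) : Reduced B ⊗[ZMod 2] Cochain B →ₗ[ZMod 2] Cochain B :=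
  LinearMap.mul' (ZMod 2) _ ∘ₗ (TensorProduct.comm (ZMod 2) _ _).toLinearMap ∘ₗ
    TensorProduct.map (cons B ∘ₗ LinearMap.mulRight (ZMod 2) (twist B c) ∘ₗ
      (TensorProduct.mk (ZMod 2) B (Cochain B)).flip 1 ∘ₗ reducedSection B) LinearMap.id

theorem insertCochain_tmul (c : Cochain B) (v : Reduced B) (t : Cochain B) :
    insertCochain c (v ⊗ₜ t) = t * cons B (reducedSection B v ⊗ₜ 1 * twist B c) := rfl

theorem coaction_insertCochain (c : Cochain B) (x : Reduced B ⊗[ZMod 2] Cochain B) :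
    coaction B (insertCochain c x) = (insertCochain c).lTensor B (coactionR B x) +
      shear B x * 1 ⊗ₜ d B c := by
  induction x using TensorProduct.induction_on with
  | zero => simp
  | add x y hx hy =>
    simp only [map_add, hx, hy, add_mul]
    abel
  | tmul v t =>
    rw [insertCochain_tmul, map_mul, coaction_cons, map_mul, coaction3_twist, coaction3_tmul, map_one,
      map_one, mul_one, comul_section]
    have h1 : ∀ p : B ⊗[ZMod 2] B, (cons B).lTensor B (left3 B p * 1 ⊗ₜ twist B c) =
        (cons B ∘ₗ LinearMap.mulRight (ZMod 2) (twist B c) ∘ₗ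
          (TensorProduct.mk (ZMod 2) B (Cochain B)).flip 1).lTensor B p := by
      intro p
      induction p using TensorProduct.induction_on with
      | zero => simp
      | add p p' hp hp' => simp only [map_add, add_mul, hp, hp']
      | tmul a w => simp [left3]
    rw [h1, map_add, mul_add]
    congr 1
    · have h2 : ∀ (p : B ⊗[ZMod 2] Reduced B) (q : B ⊗[ZMod 2] Cochain B),
          q * (cons B ∘ₗ LinearMap.mulRight (ZMod 2) (twist B c) ∘ₗ
            (TensorProduct.mk (ZMod 2) B (Cochain B)).flip 1).lTensor B
              ((reducedSection B).lTensor B p) = (insertCochain c).lTensor B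
          ((LinearMap.mul' (ZMod 2) B).rTensor _
            (TensorProduct.tensorTensorTensorComm (ZMod 2) B (Reduced B) B (Cochain B)
              (p ⊗ₜ q))) := by
        intro p q
        induction p using TensorProduct.induction_on with
        | zero => simp
        | add p p' hp hp' => simp only [map_add, mul_add, TensorProduct.add_tmul, hp, hp']
        | tmul a w =>
          induction q using TensorProduct.induction_on with
          | zero => simp
          | add q q' hq hq' => simp only [map_add, add_mul, TensorProduct.tmul_add, hq, hq']
          | tmul e s => simp [insertCochain_tmul, mul_comm]
      rw [h2]
      rfl
    · have h3 : shear B (v ⊗ₜ t) = reducedSection B v ⊗ₜ 1 * coaction B t := rfl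
      have h4 : reducedSection B v ⊗ₜ[ZMod 2] (1 : Cochain B) * coaction B t =
          coaction B t * reducedSection B v ⊗ₜ[ZMod 2] (1 : Cochain B) := by
        generalize coaction B t = q
        induction q using TensorProduct.induction_on with
        | zero => simp
        | add q q' hq hq' => simp only [mul_add, add_mul, hq, hq']
        | tmul e s => simp [mul_comm]
      rw [h3, h4, mul_assoc]
      simp [d_apply, ← Algebra.TensorProduct.one_def]

theorem antipode_shear (x : Reduced B ⊗[ZMod 2] Cochain B) (hx : coactionR B x = 1 ⊗ₜ x) :
    Algebra.TensorProduct.map (antipodeAlgHom (ZMod 2) B) (AlgHom.id (ZMod 2) (Cochain B))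
      (shear B x) = -(reducedSection B).rTensor (Cochain B) x := by
  let H : B ⊗[ZMod 2] (Reduced B ⊗[ZMod 2] Cochain B) →ₗ[ZMod 2] B ⊗[ZMod 2] Cochain B :=
    (LinearMap.mul' (ZMod 2) B).rTensor _ ∘ₗ
      (TensorProduct.assoc (ZMod 2) B B (Cochain B)).symm.toLinearMap ∘ₗ
        TensorProduct.map (antipode (ZMod 2)) ((reducedSection B).rTensor (Cochain B))
  have h1 : ∀ y, H (1 ⊗ₜ y) = (reducedSection B).rTensor (Cochain B) y := by
    intro y
    induction y using TensorProduct.induction_on with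
    | zero => simp
    | add x y hx hy => simp only [TensorProduct.tmul_add, map_add, hx, hy]
    | tmul v t => simp [H]
  have h2 : ∀ y, H (coactionR B y) =
      - Algebra.TensorProduct.map (antipodeAlgHom (ZMod 2) B) (AlgHom.id (ZMod 2) (Cochain B))
        (shear B y) := by
    intro y
    induction y using TensorProduct.induction_on with
    | zero => simp
    | add x y hx hy => simp only [map_add, hx, hy, neg_add]
    | tmul v t =>
      have h3 : ∀ (p : B ⊗[ZMod 2] Reduced B) (q : B ⊗[ZMod 2] Cochain B),
          H ((LinearMap.mul' (ZMod 2) B).rTensor _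
            (TensorProduct.tensorTensorTensorComm (ZMod 2) B (Reduced B) B (Cochain B)
              (p ⊗ₜ q))) =
          (LinearMap.mul' (ZMod 2) B (TensorProduct.map (antipode (ZMod 2)) (reducedSection B) p)) ⊗ₜ 1 *
            Algebra.TensorProduct.map (antipodeAlgHom (ZMod 2) B)
              (AlgHom.id (ZMod 2) (Cochain B)) q := by
        intro p q
        induction p using TensorProduct.induction_on with
        | zero => simp
        | add p p' hp hp' => simp only [map_add, add_mul, TensorProduct.add_tmul, hp, hp']
        | tmul a w =>
          induction q using TensorProduct.induction_on with
          | zero => simp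
          | add q q' hq hq' => simp only [map_add, mul_add, TensorProduct.tmul_add, hq, hq']
          | tmul e s =>
            simp only [H, TensorProduct.tensorTensorTensorComm_tmul, LinearMap.rTensor_tmul,
              LinearMap.mul'_apply, LinearMap.comp_apply, TensorProduct.map_tmul,
              LinearEquiv.coe_coe, TensorProduct.assoc_symm_tmul, antipode_mul_distrib,
              Algebra.TensorProduct.map_tmul, Algebra.TensorProduct.tmul_mul_tmul,
              antipodeAlgHom_apply, AlgHom.id_apply, one_mul]
            congr 1
            ring
      have h4 := h3 (reducedCoaction B v) (coaction B t)
      rw [mul_section] at h4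
      have h5 : shear B (v ⊗ₜ t) = reducedSection B v ⊗ₜ 1 * coaction B t := rfl
      refine h4.trans ?_
      rw [h5, map_mul, TensorProduct.neg_tmul, neg_mul]
      simp
  rw [← h1 x, ← hx, h2, neg_neg]

theorem d_one : d B 1 = 0 := by
  rw [d_eq_zero_iff, map_one, Algebra.TensorProduct.one_def]

/-- The product of a cocycle and a coboundary is a coboundary. -/
theorem exists_d_eq_mul_d {z : Cochain B} (hz : d B z = 0) (c : Cochain B) :
    ∃ e, d B e = z * d B c := by
  obtain ⟨r, x, hrx⟩ : ∃ r x, z = algebraMap (ZMod 2) (Cochain B) r + consR B x :=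
    ⟨(uncons B z).1, (uncons B z).2, by
      conv_lhs => rw [← unconsAux_uncons z]
      rfl⟩
  have hx : d B (consR B x) = 0 := by
    rw [hrx, map_add, Algebra.algebraMap_eq_smul_one, map_smul, d_one, smul_zero, zero_add] at hz
    exact hz
  have hx2 : coactionR B x = 1 ⊗ₜ x := by
    have h := (d_eq_zero_iff _).1 hx
    rw [coaction_consR, ← LinearMap.lTensor_tmul] at h
    have hK : (LinearMap.snd _ _ _ ∘ₗ uncons B) ∘ₗ consR B = LinearMap.id :=
      LinearMap.ext uncons_consR
    have h2 := congrArg ((LinearMap.snd _ _ _ ∘ₗ uncons B).lTensor B) h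
    rw [← LinearMap.comp_apply, ← LinearMap.comp_apply, ← LinearMap.lTensor_comp, hK,
      LinearMap.lTensor_id] at h2
    simpa [uncons_consR] using h2
  have h3 : cons B ((reducedSection B).rTensor (Cochain B) x) = consR B x := by
    rw [cons_eq, ← LinearMap.comp_apply (LinearMap.rTensor _ _), ← LinearMap.rTensor_comp]
    have : toReduced B ∘ₗ reducedSection B = LinearMap.id := LinearMap.ext toReduced_reducedSection
    rw [this, LinearMap.rTensor_id, LinearMap.id_apply]
  have h4 : d B (insertCochain c x) = -(consR B x * d B c) := by
    rw [d_apply, twist, AlgHom.comp_apply, coaction_insertCochain, hx2, LinearMap.lTensor_tmul,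
      map_add, map_mul, antipode_shear x hx2, map_add]
    simp only [Algebra.TensorProduct.map_tmul, map_one, AlgHom.id_apply]
    rw [cons_tmul, bar_one, zero_mul, zero_add, cons_mul, map_neg, h3, neg_mul]
  refine ⟨r • c - insertCochain c x, ?_⟩
  rw [map_sub, h4, map_smul, hrx, add_mul, sub_neg_eq_add, Algebra.smul_def]

end Proofs

/-- The cocycles form an algebra under concatenation. -/
def cocycles : Subalgebra (ZMod 2) (Cochain B) where
  carrier := {z | d B z = 0}
  mul_mem' {a b} ha hb := by
    change d B (a * b) = 0
    rw [d_mul hb, ha, zero_mul]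
  add_mem' {a b} ha hb := by
    change d B (a + b) = 0
    rw [map_add, ha, hb, add_zero]
  algebraMap_mem' r := by
    change d B _ = 0
    rw [Algebra.algebraMap_eq_smul_one, map_smul, d_one, smul_zero]

/-- The coboundaries form a two-sided ideal of the algebra of cocycles. -/
def coboundaries : Ideal (cocycles B) where
  carrier := {z | ∃ c, d B c = z}
  add_mem' := by
    rintro a b ⟨c, hc⟩ ⟨e, he⟩
    exact ⟨c + e, by rw [map_add, hc, he]; rfl⟩
  zero_mem' := ⟨0, map_zero _⟩
  smul_mem' := by
    rintro z a ⟨c, hc⟩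
    obtain ⟨e, he⟩ := exists_d_eq_mul_d z.2 c
    exact ⟨e, by rw [he, hc]; rfl⟩

instance : (coboundaries B).IsTwoSided where
  mul_mem_of_left {a} z := by
    rintro ⟨c, hc⟩
    exact ⟨c * z, by rw [d_mul z.2, hc]; rfl⟩

/-- The total cohomology algebra of the Hopf algebra dual to `B`, that is, the direct sum of its
cohomology groups over all bidegrees. The product, induced by concatenation of cocycles,
is the Yoneda product. -/
abbrev Cohomology : Type _ := cocycles B ⧸ coboundaries B

/-- The cohomology class of a cocycle. -/
def classOf : cocycles B →ₐ[ZMod 2] Cohomology B := Ideal.Quotient.mkₐ (ZMod 2) (coboundaries B)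

theorem d_bar_of_primitive {b : B} (hb : Coalgebra.comul b = b ⊗ₜ[ZMod 2] 1 + 1 ⊗ₜ b) :
    d B (bar B b) = 0 := by
  rw [d_eq_zero_iff, coaction_bar, hb, map_add, LinearMap.lTensor_tmul, LinearMap.lTensor_tmul,
    bar_one, TensorProduct.tmul_zero, zero_add]

/-- The class of the one-fold cocycle `[b]`, for `b` primitive. -/
def primitiveClass (b : B) (hb : Coalgebra.comul b = b ⊗ₜ[ZMod 2] 1 + 1 ⊗ₜ b) : Cohomology B :=
  classOf B ⟨bar B b, d_bar_of_primitive B hb⟩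

end HopfBar

namespace Transfer

open DualSteenrod HopfBar

/-- The power series `∑_t ξ_t x^{2^t - 1}`; the coaction of `A_*` on `H^*(BZ/2) = F_2[x]` sends
`x` to `x` times this series. -/
def unitSeries : PowerSeries DualSteenrod :=
  PowerSeries.mk fun n => ∑ t ∈ Finset.range (n + 1), if 2 ^ t = n + 1 then xi t else 0

/-- The total Steenrod operation `x ↦ ∑_t ξ_t x^{2^t}` on the generator of `H^*(BZ/2)`. -/
def genSeries : PowerSeries DualSteenrod := PowerSeries.X * unitSeries

/-- The total Steenrod operation on `x^{-1}`, multiplied by `x`: by the Cartan formula it is the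
inverse of `∑_t ξ_t x^{2^t - 1}`. -/
def invSeries : PowerSeries DualSteenrod := PowerSeries.invOfUnit unitSeries 1

theorem coeff_genSeries_two_pow (t : ℕ) : PowerSeries.coeff (2 ^ t) genSeries = xi t := by
  obtain ⟨n, hn⟩ := Nat.exists_eq_succ_of_ne_zero (pow_ne_zero t (two_ne_zero (α := ℕ)))
  rw [genSeries, hn, Nat.succ_eq_add_one, PowerSeries.coeff_succ_X_mul, unitSeries,
    PowerSeries.coeff_mk, Finset.sum_eq_single t]
  · rw [if_pos hn]
  · intro s _ hs
    rw [if_neg]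
    intro h
    exact hs (Nat.pow_right_injective le_rfl (h.trans hn.symm))
  · intro h
    exfalso
    apply h
    rw [Finset.mem_range]
    have := Nat.lt_two_pow_self (n := t)
    omega

theorem coeff_genSeries_eq_zero (n : ℕ) (h : ∀ t, n ≠ 2 ^ t) :
    PowerSeries.coeff n genSeries = 0 := by
  cases n with
  | zero => simp [genSeries]
  | succ n =>
    rw [genSeries, PowerSeries.coeff_succ_X_mul, unitSeries, PowerSeries.coeff_mk]
    exact Finset.sum_eq_zero fun t _ => if_neg fun ht => h t ht.symm

theorem constantCoeff_unitSeries : PowerSeries.constantCoeff unitSeries = 1 := by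
  rw [← PowerSeries.coeff_zero_eq_constantCoeff_apply, unitSeries, PowerSeries.coeff_mk]
  simp

theorem unit_mul_inv : unitSeries * invSeries = 1 :=
  PowerSeries.mul_invOfUnit _ _ constantCoeff_unitSeries

theorem constantCoeff_genSeries : PowerSeries.constantCoeff genSeries = 0 := by
  simp [genSeries]

instance : CharP DualSteenrod 2 := inferInstanceAs (CharP (MvPolynomial ℕ (ZMod 2)) 2)

theorem coeff_genSeries_pow (n i : ℕ) : PowerSeries.coeff n (genSeries ^ 2 ^ i) =
    if 2 ^ i ∣ n then PowerSeries.coeff (n / 2 ^ i) genSeries ^ 2 ^ i else 0 := by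
  have h : PowerSeries.map (iterateFrobenius DualSteenrod 2 i)
      (PowerSeries.expand (2 ^ i) (pow_ne_zero i two_ne_zero) genSeries) = genSeries ^ 2 ^ i :=
    MvPowerSeries.map_iterateFrobenius_expand 2 two_ne_zero genSeries i
  rw [← h, PowerSeries.coeff_map, PowerSeries.coeff_expand]
  split_ifs
  · rfl
  · exact map_zero _

theorem coeff_mul_subst {R : Type*} [CommRing R] (P G W : PowerSeries R)
    (hW : PowerSeries.constantCoeff W = 0) (n : ℕ) :
    PowerSeries.coeff n (P * G.subst W) =
      ∑ l ∈ Finset.range (n + 1), PowerSeries.coeff l G * PowerSeries.coeff n (P * W ^ l) := by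
  have hs : PowerSeries.HasSubst W := PowerSeries.HasSubst.of_constantCoeff_zero' hW
  obtain ⟨W', hW'⟩ := PowerSeries.X_dvd_iff.2 hW
  have h1 : G = PowerSeries.X ^ (n + 1) * PowerSeries.mk (fun i => PowerSeries.coeff (i + (n + 1)) G)
      + (PowerSeries.trunc (n + 1) G : PowerSeries R) :=
    PowerSeries.eq_X_pow_mul_shift_add_trunc (n + 1) G
  have h2 : G.subst W = W ^ (n + 1) *
      (PowerSeries.mk (fun i => PowerSeries.coeff (i + (n + 1)) G)).subst W
      + ∑ l ∈ Finset.range (n + 1), PowerSeries.C (PowerSeries.coeff l G) * W ^ l := by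
    conv_lhs => rw [h1]
    rw [PowerSeries.subst_add hs, PowerSeries.subst_mul hs, PowerSeries.subst_pow hs,
      PowerSeries.subst_X hs, PowerSeries.subst_coe hs, Polynomial.aeval_def,
      PowerSeries.eval₂_trunc_eq_sum_range]
    rfl
  rw [h2, mul_add, map_add]
  have h3 : PowerSeries.coeff n (P * (W ^ (n + 1) *
      (PowerSeries.mk (fun i => PowerSeries.coeff (i + (n + 1)) G)).subst W)) = 0 := by
    have hdvd : (PowerSeries.X : PowerSeries R) ^ (n + 1) ∣ P * (W ^ (n + 1) *
        (PowerSeries.mk (fun i => PowerSeries.coeff (i + (n + 1)) G)).subst W) := by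
      refine Dvd.dvd.mul_left (Dvd.dvd.mul_right ?_ _) _
      rw [hW', mul_pow]
      exact dvd_mul_right _ _
    exact PowerSeries.X_pow_dvd_iff.1 hdvd n (Nat.lt_succ_self n)
  rw [h3, zero_add, Finset.mul_sum, map_sum]
  refine Finset.sum_congr rfl fun l _ => ?_
  rw [mul_left_comm, PowerSeries.coeff_C_mul]

/-- The composition law of the total Steenrod operations. -/
theorem map_comul_genSeries (n : ℕ) :
    Coalgebra.comul (R := ZMod 2) (PowerSeries.coeff n genSeries) =
      ∑ d ∈ Finset.range (n + 1), PowerSeries.coeff n (genSeries ^ d) ⊗ₜ[ZMod 2]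
        PowerSeries.coeff d genSeries := by
  by_cases h : ∃ s, n = 2 ^ s
  · obtain ⟨s, rfl⟩ := h
    rw [coeff_genSeries_two_pow, comul_xi]
    refine Finset.sum_of_injOn (fun p => 2 ^ p.2) ?_ ?_ ?_ ?_
    · rintro ⟨a, i⟩ hp ⟨b, j⟩ hq hpq
      simp only [Finset.mem_coe, Finset.HasAntidiagonal.mem_antidiagonal] at hp hq
      have hij : i = j := Nat.pow_right_injective le_rfl hpq
      subst hij
      have hab : a = b := by omega
      rw [hab]
    · rintro ⟨a, i⟩ hp
      simp only [Finset.mem_coe, Finset.HasAntidiagonal.mem_antidiagonal, Finset.mem_range] at hp ⊢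
      exact Nat.lt_succ_of_le (Nat.pow_le_pow_right (by norm_num) (by omega))
    · intro d _ hd
      by_cases hd' : ∃ i, d = 2 ^ i
      · obtain ⟨i, rfl⟩ := hd'
        rw [coeff_genSeries_pow, if_neg, TensorProduct.zero_tmul]
        intro hdvd
        have his : i ≤ s := (Nat.pow_dvd_pow_iff_le_right (by norm_num)).1 hdvd
        exact hd ⟨(s - i, i), by
          simp only [Finset.mem_coe, Finset.HasAntidiagonal.mem_antidiagonal]; omega, rfl⟩
      · push Not at hd'
        rw [coeff_genSeries_eq_zero d hd', TensorProduct.tmul_zero]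
    · rintro ⟨a, i⟩ hp
      rw [Finset.HasAntidiagonal.mem_antidiagonal] at hp
      change a + i = s at hp
      subst hp
      change _ = PowerSeries.coeff (2 ^ (a + i)) (genSeries ^ 2 ^ i) ⊗ₜ[ZMod 2]
        PowerSeries.coeff (2 ^ i) genSeries
      rw [coeff_genSeries_pow, if_pos (pow_dvd_pow 2 (by omega)), pow_add,
        Nat.mul_div_cancel _ (by positivity), coeff_genSeries_two_pow, coeff_genSeries_two_pow]
  · push Not at h
    rw [coeff_genSeries_eq_zero n h, map_zero, eq_comm]
    refine Finset.sum_eq_zero fun d _ => ?_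
    by_cases hd' : ∃ i, d = 2 ^ i
    · obtain ⟨i, rfl⟩ := hd'
      rw [coeff_genSeries_pow]
      split_ifs with hd
      · rw [coeff_genSeries_eq_zero, zero_pow (by positivity), TensorProduct.zero_tmul]
        rintro t ht
        obtain ⟨e, rfl⟩ := hd
        rw [Nat.mul_div_cancel_left _ (by positivity)] at ht
        exact h (i + t) (by rw [ht, pow_add])
      · rw [TensorProduct.zero_tmul]
    · push Not at hd'
      rw [coeff_genSeries_eq_zero d hd', TensorProduct.tmul_zero]

/-- The coproduct of the coefficients of `invSeries`. -/
theorem comul_invSeries (k : ℕ) :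
    Coalgebra.comul (R := ZMod 2) (PowerSeries.coeff (k + 1) invSeries) =
      PowerSeries.coeff (k + 1) invSeries ⊗ₜ[ZMod 2] 1 +
      ∑ j ∈ Finset.range (k + 1), PowerSeries.coeff k (genSeries ^ j) ⊗ₜ[ZMod 2]
        PowerSeries.coeff (j + 1) invSeries := by
  let i1 : DualSteenrod →+* DualSteenrod ⊗[ZMod 2] DualSteenrod :=
    (Algebra.TensorProduct.includeLeft :
      DualSteenrod →ₐ[ZMod 2] DualSteenrod ⊗[ZMod 2] DualSteenrod).toRingHom
  let i2 : DualSteenrod →+* DualSteenrod ⊗[ZMod 2] DualSteenrod :=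
    (Algebra.TensorProduct.includeRight :
      DualSteenrod →ₐ[ZMod 2] DualSteenrod ⊗[ZMod 2] DualSteenrod).toRingHom
  let δ : DualSteenrod →+* DualSteenrod ⊗[ZMod 2] DualSteenrod :=
    (Bialgebra.comulAlgHom (ZMod 2) DualSteenrod).toRingHom
  set W := PowerSeries.map i1 genSeries with hW
  have hW0 : PowerSeries.constantCoeff W = 0 := by
    rw [hW, ← PowerSeries.coeff_zero_eq_constantCoeff_apply, PowerSeries.coeff_map,
      PowerSeries.coeff_zero_eq_constantCoeff_apply, constantCoeff_genSeries, map_zero]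
  have hs : PowerSeries.HasSubst W := PowerSeries.HasSubst.of_constantCoeff_zero' hW0
  have i12 : ∀ a b, i2 b * i1 a = a ⊗ₜ[ZMod 2] b := by
    intro a b
    change ((1 : DualSteenrod) ⊗ₜ[ZMod 2] b) * (a ⊗ₜ[ZMod 2] (1 : DualSteenrod)) = _
    rw [Algebra.TensorProduct.tmul_mul_tmul, one_mul, mul_one]
  have hgen : PowerSeries.map δ genSeries = (PowerSeries.map i2 genSeries).subst W := by
    ext n
    rw [← one_mul ((PowerSeries.map i2 genSeries).subst W), coeff_mul_subst 1 _ W hW0,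
      PowerSeries.coeff_map]
    refine (map_comul_genSeries n).trans (Finset.sum_congr rfl fun d _ => ?_)
    rw [one_mul, hW, ← map_pow, PowerSeries.coeff_map, PowerSeries.coeff_map, i12]
  have hWX : W = PowerSeries.X * PowerSeries.map i1 unitSeries := by
    rw [hW, genSeries, map_mul, PowerSeries.map_X]
  have hunit : PowerSeries.map δ unitSeries = PowerSeries.map i1 unitSeries *
      (PowerSeries.map i2 unitSeries).subst W := by
    have h1 : PowerSeries.X * PowerSeries.map δ unitSeries = PowerSeries.X *
        (PowerSeries.map i1 unitSeries * (PowerSeries.map i2 unitSeries).subst W) := by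
      rw [← mul_assoc, ← hWX, ← PowerSeries.map_X δ, ← map_mul, ← genSeries, hgen, genSeries,
        map_mul, PowerSeries.map_X, PowerSeries.subst_mul hs, PowerSeries.subst_X hs]
    exact PowerSeries.X_mul_cancel h1
  have hone : (1 : PowerSeries (DualSteenrod ⊗[ZMod 2] DualSteenrod)).subst W = 1 := by
    rw [← PowerSeries.coe_substAlgHom hs, map_one]
  have hinv : PowerSeries.map δ invSeries = PowerSeries.map i1 invSeries *
      (PowerSeries.map i2 invSeries).subst W := by
    have h1 : PowerSeries.map δ unitSeries * PowerSeries.map δ invSeries = 1 := by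
      rw [← map_mul, unit_mul_inv, map_one]
    have h2 : PowerSeries.map i1 unitSeries * PowerSeries.map i1 invSeries = 1 := by
      rw [← map_mul, unit_mul_inv, map_one]
    have h3 : (PowerSeries.map i2 unitSeries).subst W * (PowerSeries.map i2 invSeries).subst W =
        1 := by
      rw [← PowerSeries.subst_mul hs, ← map_mul, unit_mul_inv, map_one, hone]
    have h4 : PowerSeries.map δ unitSeries * (PowerSeries.map i1 invSeries *
        (PowerSeries.map i2 invSeries).subst W) = 1 := by
      rw [hunit, mul_mul_mul_comm, h2, h3, mul_one]
    exact (eq_comm.1 (left_inv_eq_right_inv (by rw [mul_comm]; exact h4) h1))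
  have h := congrArg (PowerSeries.coeff (k + 1)) hinv
  rw [PowerSeries.coeff_map, coeff_mul_subst _ _ W hW0, Finset.sum_range_succ'] at h
  refine Eq.trans h ?_
  rw [add_comm]
  congr 1
  · rw [pow_zero, mul_one, PowerSeries.coeff_map, PowerSeries.coeff_map, i12]
    congr 1
    rw [invSeries, PowerSeries.coeff_zero_eq_constantCoeff_apply,
      PowerSeries.constantCoeff_invOfUnit]
    rfl
  · refine Finset.sum_congr rfl fun l _ => ?_
    have h2 : PowerSeries.map i1 invSeries * W ^ (l + 1) =
        PowerSeries.X * PowerSeries.map i1 (genSeries ^ l) := by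
      rw [pow_succ', map_pow, ← hW]
      have h3 : PowerSeries.map i1 unitSeries * PowerSeries.map i1 invSeries = 1 := by
        rw [← map_mul, unit_mul_inv, map_one]
      linear_combination (PowerSeries.X * W ^ l) * h3 + (PowerSeries.map i1 invSeries * W ^ l) * hWX
    rw [h2, PowerSeries.coeff_succ_X_mul, PowerSeries.coeff_map, PowerSeries.coeff_map, i12]

/-- The direct sum over `n` of the homology groups `H_*(BV_n) = H_*(BZ/2)^{⊗ n}`, with the
product by concatenation: the free associative algebra on the generators `b_k` of
`H_k(BZ/2)`, `k ≥ 0`. The words of length `n` span `H_*(BV_n)`. -/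
abbrev Homology : Type := FreeAlgebra (ZMod 2) ℕ

/-- The class `b_k`, dual to `x^k`. -/
def b (k : ℕ) : Homology := FreeAlgebra.ι (ZMod 2) k

variable {B : Type*} [CommRing B] [HopfAlgebra (ZMod 2) B] (π : DualSteenrod →ₐc[ZMod 2] B)

/-- The coaction on homology dual to the action of the sub-Hopf algebra with dual `B` on
cohomology. On `b_k` it is `∑_j c_{j,k} ⊗ b_j`, with `c_{j,k}` the coefficient of `x^k` in
`(∑_t ξ_t x^{2^t})^j`; on products it is multiplicative (the Cartan formula). -/
def coaction : Homology →ₐ[ZMod 2] B ⊗[ZMod 2] Homology :=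
  FreeAlgebra.lift (ZMod 2) fun k =>
    ∑ j ∈ Finset.range (k + 1), π (PowerSeries.coeff k (genSeries ^ j)) ⊗ₜ[ZMod 2] b j

/-- The right action of an operation, viewed as a functional `θ` on `B`. -/
def act (x : Homology) (θ : Module.Dual (ZMod 2) B) : Homology :=
  TensorProduct.lid (ZMod 2) Homology (θ.rTensor Homology (coaction π x))

theorem coaction_b (k : ℕ) : coaction π (b k) = ∑ j ∈ Finset.range (k + 1),
    π (PowerSeries.coeff k (genSeries ^ j)) ⊗ₜ[ZMod 2] b j := by
  rw [coaction, b, FreeAlgebra.lift_ι_apply]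

theorem counit_coaction (x : Homology) :
    (Coalgebra.counit (R := ZMod 2) (A := B)).rTensor Homology (coaction π x) = 1 ⊗ₜ x := by
  suffices h : (Algebra.TensorProduct.map (Bialgebra.counitAlgHom (ZMod 2) B)
      (AlgHom.id (ZMod 2) Homology)).comp (coaction π) =
      Algebra.TensorProduct.includeRight from DFunLike.congr_fun h x
  refine FreeAlgebra.hom_ext (funext fun k => ?_)
  change Algebra.TensorProduct.map (Bialgebra.counitAlgHom (ZMod 2) B)
      (AlgHom.id (ZMod 2) Homology) (coaction π (b k)) = 1 ⊗ₜ b k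
  have hg : PowerSeries.map (Bialgebra.counitAlgHom (ZMod 2) DualSteenrod).toRingHom genSeries =
      PowerSeries.X := by
    ext n
    rw [PowerSeries.coeff_map, PowerSeries.coeff_X]
    change Coalgebra.counit (R := ZMod 2) (PowerSeries.coeff n genSeries) = _
    by_cases h : ∃ s, n = 2 ^ s
    · obtain ⟨s, rfl⟩ := h
      rw [coeff_genSeries_two_pow, counit_xi]
      simp
    · push Not at h
      rw [coeff_genSeries_eq_zero n h, map_zero, if_neg]
      exact h 0
  have hc : ∀ j, Coalgebra.counit (R := ZMod 2)
      (π (PowerSeries.coeff k (genSeries ^ j))) = if k = j then 1 else 0 := by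
    intro j
    rw [CoalgHomClass.counit_comp_apply]
    have := congrArg (PowerSeries.coeff k) (congrArg (· ^ j) hg)
    simp only [← map_pow, PowerSeries.coeff_map, PowerSeries.coeff_X_pow] at this
    exact this
  rw [coaction_b, map_sum]
  simp only [Algebra.TensorProduct.map_tmul, Bialgebra.counitAlgHom_apply, hc, AlgHom.id_apply]
  rw [Finset.sum_eq_single k]
  · simp
  · intro j _ hj
    rw [if_neg hj.symm, TensorProduct.zero_tmul]
  · simp

/-- An element is annihilated by the augmentation ideal if and only if it is primitive. -/
theorem forall_act_eq_zero_iff (x : Homology) :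
    (∀ θ : Module.Dual (ZMod 2) B, θ 1 = 0 → act π x θ = 0) ↔ coaction π x = 1 ⊗ₜ x := by
  constructor
  · intro h
    let p : B →ₗ[ZMod 2] B := LinearMap.id - Algebra.linearMap (ZMod 2) B ∘ₗ Coalgebra.counit
    have hp : p 1 = 0 := by simp [p]
    have h0 : p.rTensor Homology (coaction π x) = 0 := by
      let e := Module.Free.chooseBasis (ZMod 2) B
      apply (TensorProduct.equivFinsuppOfBasisLeft e (N := Homology)).injective
      rw [map_zero]
      ext1 i
      rw [TensorProduct.equivFinsuppOfBasisLeft_apply, Finsupp.zero_apply,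
        ← LinearMap.comp_apply (LinearMap.rTensor _ _), ← LinearMap.rTensor_comp]
      exact h (e.coord i ∘ₗ p) (by rw [LinearMap.comp_apply, hp, map_zero])
    rw [LinearMap.rTensor_sub, LinearMap.sub_apply, LinearMap.rTensor_id, LinearMap.id_apply,
      LinearMap.rTensor_comp, LinearMap.comp_apply, counit_coaction, sub_eq_zero] at h0
    rw [h0]
    simp
  · intro h θ hθ
    rw [act, h, LinearMap.rTensor_tmul, hθ, TensorProduct.zero_tmul, map_zero]

/-- The algebra of annihilated elements: those killed by all operations in the augmentation
ideal, the operations being the functionals on `B` and the augmentation the evaluation at `1`. -/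
def annihilated : Subalgebra (ZMod 2) Homology where
  carrier := {x | ∀ θ : Module.Dual (ZMod 2) B, θ 1 = 0 → act π x θ = 0}
  mul_mem' {x y} hx hy := by
    rw [Set.mem_ofPred_eq, forall_act_eq_zero_iff] at hx hy ⊢
    rw [map_mul, hx, hy, Algebra.TensorProduct.tmul_mul_tmul, one_mul]
  add_mem' {x y} hx hy := by
    rw [Set.mem_ofPred_eq, forall_act_eq_zero_iff] at hx hy ⊢
    rw [map_add, hx, hy, TensorProduct.tmul_add]
  algebraMap_mem' r := by
    rw [Set.mem_ofPred_eq, forall_act_eq_zero_iff, AlgHom.commutes]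
    simp [Algebra.algebraMap_eq_smul_one, Algebra.TensorProduct.one_def]

/-- The chain-level transfer: multiplicative, and on `b_k` the image in `B` of the coefficient of
`x^k` in the total Steenrod operation on `x^{-1}`. -/
def chainMap : Homology →ₐ[ZMod 2] Cochain B :=
  FreeAlgebra.lift (ZMod 2) fun k => bar B (π (PowerSeries.coeff (k + 1) invSeries))

theorem chainMap_b (k : ℕ) :
    chainMap π (b k) = bar B (π (PowerSeries.coeff (k + 1) invSeries)) := by
  rw [chainMap, b, FreeAlgebra.lift_ι_apply]

theorem coaction_chainMap (x : Homology) : HopfBar.coaction B (chainMap π x) =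
    (chainMap π).toLinearMap.lTensor B (coaction π x) := by
  suffices h : (HopfBar.coaction B).comp (chainMap π) =
      (Algebra.TensorProduct.map (AlgHom.id (ZMod 2) B) (chainMap π)).comp (coaction π) from
    DFunLike.congr_fun h x
  refine FreeAlgebra.hom_ext (funext fun k => ?_)
  change HopfBar.coaction B (chainMap π (b k)) =
    Algebra.TensorProduct.map (AlgHom.id (ZMod 2) B) (chainMap π) (coaction π (b k))
  have h : Coalgebra.comul (R := ZMod 2) (π (PowerSeries.coeff (k + 1) invSeries)) =
      TensorProduct.map (π : DualSteenrod →ₗ[ZMod 2] B) (π : DualSteenrod →ₗ[ZMod 2] B)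
        (Coalgebra.comul (R := ZMod 2) (PowerSeries.coeff (k + 1) invSeries)) :=
    (CoalgHomClass.map_comp_comul_apply π _).symm
  rw [chainMap_b, coaction_bar, h, comul_invSeries, coaction_b]
  simp [chainMap_b, bar_one]

theorem chainMap_mem (x : annihilated π) : chainMap π x ∈ cocycles B := by
  have hx := (forall_act_eq_zero_iff π x.1).1 x.2
  change d B (chainMap π x.1) = 0
  rw [d_eq_zero_iff, coaction_chainMap, hx]
  rfl

end Transfer

/-- The total transfer of the sub-Hopf algebra of the Steenrod algebra with dual `B`, an algebra
homomorphism from the annihilated elements to the cohomology. -/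
def transfer {B : Type*} [CommRing B] [HopfAlgebra (ZMod 2) B] (π : DualSteenrod →ₐc[ZMod 2] B) :
    Transfer.annihilated π →ₐ[ZMod 2] HopfBar.Cohomology B :=
  (HopfBar.classOf B).comp
    (((Transfer.chainMap π).comp (Transfer.annihilated π).val).codRestrict (HopfBar.cocycles B)
      (Transfer.chainMap_mem π))

namespace ElementaryDual

/-- The pairs `(t, s)` with `s < m ≤ t`. -/
abbrev Index (m : ℕ) : Type := {p : ℕ × ℕ // p.2 < m ∧ m ≤ p.1}

theorem comul_proj_xi {m t : ℕ} (ht : 0 < t) (s : ℕ) :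
    Coalgebra.comul (R := ZMod 2) (proj m (DualSteenrod.xi t ^ 2 ^ s)) =
      proj m (DualSteenrod.xi t ^ 2 ^ s) ⊗ₜ[ZMod 2] 1 +
        1 ⊗ₜ proj m (DualSteenrod.xi t ^ 2 ^ s) := by
  have hmk : ∀ {y : DualSteenrod}, y ∈ elementaryIdeal m → proj m y = 0 := fun hy =>
    Ideal.Quotient.eq_zero_iff_mem.2 hy
  have h1 : Coalgebra.comul (R := ZMod 2) (proj m (DualSteenrod.xi t)) =
      proj m (DualSteenrod.xi t) ⊗ₜ[ZMod 2] 1 + 1 ⊗ₜ proj m (DualSteenrod.xi t) := by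
    rw [← CoalgHomClass.map_comp_comul_apply (proj m), DualSteenrod.comul_xi, map_sum]
    have hne : ((t, 0) : ℕ × ℕ) ≠ (0, t) := by
      intro h
      rw [Prod.mk.injEq] at h
      omega
    rw [← Finset.sum_subset (s₁ := {((t, 0) : ℕ × ℕ), (0, t)}), Finset.sum_pair hne]
    · simp
    · rintro ⟨a, i⟩ h
      simp only [Finset.mem_insert, Finset.mem_singleton, Prod.mk.injEq] at h
      rw [Finset.HasAntidiagonal.mem_antidiagonal]
      change a + i = t
      omega
    · rintro ⟨a, i⟩ h h'
      rw [Finset.HasAntidiagonal.mem_antidiagonal] at h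
      change a + i = t at h
      simp only [Finset.mem_insert, Finset.mem_singleton, Prod.mk.injEq] at h'
      rw [TensorProduct.map_tmul]
      rcases lt_or_ge i m with him | him
      · have : proj m (DualSteenrod.xi i) = 0 := hmk (elementaryIdeal.xi_mem (by omega) him)
        refine (congrArg _ this).trans (TensorProduct.tmul_zero _ _)
      · have : proj m (DualSteenrod.xi a ^ 2 ^ i) = 0 := by
          apply hmk
          rw [← Nat.sub_add_cancel him, pow_add, mul_comm, pow_mul]
          exact Ideal.pow_mem_of_mem _ (elementaryIdeal.xi_pow_mem (by omega)) _ (by positivity)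
        refine (congrArg (· ⊗ₜ[ZMod 2] _) this).trans (TensorProduct.zero_tmul _ _)
  have h2 := DualSteenrod.sum_pow_two_pow (Finset.univ : Finset Bool)
    (fun i => cond i (proj m (DualSteenrod.xi t) ⊗ₜ[ZMod 2] (1 : ElementaryDual m))
      (1 ⊗ₜ proj m (DualSteenrod.xi t))) s
  simp only [Fintype.univ_bool, Finset.mem_singleton, Bool.true_eq_false, not_false_eq_true,
    Finset.sum_insert, Finset.sum_singleton, cond_true, cond_false,
    Algebra.TensorProduct.tmul_pow, one_pow] at h2
  rw [map_pow, Bialgebra.comul_pow, h1, h2]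

/-- The class `h_{t,s}` in the cohomology of `E(m)`, represented by `[ξ_t^{2^s}]`. -/
def h (m : ℕ) (p : Index m) : HopfBar.Cohomology (ElementaryDual m) :=
  HopfBar.primitiveClass (ElementaryDual m) (proj m (DualSteenrod.xi p.1.1 ^ 2 ^ p.1.2))
    (comul_proj_xi (lt_of_le_of_lt (Nat.zero_le _) (lt_of_lt_of_le p.2.1 p.2.2)) _)

end ElementaryDual

end

/-!
The classes `h_{t,s}` commute because the coproduct of the product of two primitive elements `a`
and `b` shows that `[ab]` cobounds `[a|b] + [b|a]` (`HopfBar.primitiveClass_mul_comm`).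

Their algebraic independence is detected on generic exterior subalgebras. Let `K` be the polynomial
ring over `F_2` on variables `λ_{t,s}`. A functional `θ : E(m)^* → K` with `θ(1) = 0` is an element
of the augmentation ideal of `E(m)`, with scalars extended to `K`, and its square is zero
because `E(m)` is an exterior algebra (`ElementaryDual.convolution_square_eq_zero`). Choose `θ` with
`θ(ξ_t^{2^s}) = λ_{t,s}` (`ElementaryDual.exists_functional`). Restriction along
`K[θ]/(θ^2) → E(m) ⊗ K` maps the cohomology of `E(m)` to a polynomial ring in one generator `h`
over `K` and sends `h_{t,s}` to `λ_{t,s} h`; at `h = 1` this is a ring homomorphism to `K`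
(`HopfBar.detect`) which is a left inverse of `F_2[h_{t,s}] → H^*(E(m))`.

The restriction is realized at the level of the complex with the diagonal coaction as follows. Let
`Q` be the translation by `θ` on `B ⊗ K`, where `B = E(m)^*`. Cochains act on `B ⊗ K`, a generator
`[b]` acting by the commutator of `Q` with the multiplication by `b`. As `Q` is a comodule map, this
action is compatible with all coactions. Hence a cocycle, being coinvariant, acts on `1` by a scalar
(`HopfBar.rep_of_coaction`), and a coboundary `∂t` sends `1` to the translate under `Q` of a
coinvariant element, which is zero (`HopfBar.orbit_d`).

For the transfer put `k + 1 = 2^s (2^m - 1)`. Let `u = ∑_t ξ_t x^{2^t - 1}`. In `E(m)^*` one has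
`u = 1 + ξ_m x^{2^m - 1} + ⋯`, which settles the case `s = 0`. All positive exponents of `u` are
odd, so that the identities `u^{-1} = u (u^{-1})^2` and
`(x u)^{2j+1} = x u ((x u)^j)^2` express the coefficients of `x^{2^{s+1}(2^m - 1)}` in `u^{-1}` and
of `x^{2k+1}` in the odd powers of `x u` as squares of those for `s`; in the even powers of `x u`
the latter coefficient vanishes. By induction `f_*(b_k)` is
`ξ_m^{2^s}` (`ElementaryDual.proj_coeff_invSeries`) and `b_k` is annihilated
(`ElementaryDual.b_mem_annihilated`), so that `b_k` is a preimage of `h_{m,s}`.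
-/

noncomputable section

/-! ### Translations on an extended comodule -/

namespace HopfBar

open HopfAlgebra

variable {B : Type*} [CommRing B] [HopfAlgebra (ZMod 2) B]
variable {K : Type*} [CommRing K] [Algebra (ZMod 2) K]

variable (B K) in
/-- The left coaction `b ⊗ k ↦ ∑ b' ⊗ (b'' ⊗ k)` of `B` on the extended comodule `B ⊗ K`. -/
def extCoaction : B ⊗[ZMod 2] K →ₐ[ZMod 2] B ⊗[ZMod 2] (B ⊗[ZMod 2] K) :=
  (Algebra.TensorProduct.assoc (ZMod 2) (ZMod 2) (ZMod 2) B B K).toAlgHom.comp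
    (Algebra.TensorProduct.map (Bialgebra.comulAlgHom (ZMod 2) B) (AlgHom.id (ZMod 2) K))

theorem extCoaction_tmul (b : B) (k : K) : extCoaction B K (b ⊗ₜ k) =
    ((TensorProduct.mk (ZMod 2) B K).flip k).lTensor B (Coalgebra.comul b) := by
  change TensorProduct.assoc (ZMod 2) B B K (Coalgebra.comul b ⊗ₜ k) = _
  generalize (Coalgebra.comul b : B ⊗[ZMod 2] B) = c
  induction c using TensorProduct.induction_on with
  | zero => simp
  | add x y hx hy => simp only [map_add, TensorProduct.add_tmul, hx, hy]
  | tmul a b => simp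

/-- The endomorphism of the extended comodule `B ⊗ K` given by a functional on it:
`x ↦ ∑ x' ⊗ f(x'')`. -/
def contract (f : B ⊗[ZMod 2] K →ₗ[ZMod 2] K) : Module.End (ZMod 2) (B ⊗[ZMod 2] K) :=
  f.lTensor B ∘ₗ (extCoaction B K).toLinearMap

theorem contract_tmul (f : B ⊗[ZMod 2] K →ₗ[ZMod 2] K) (b : B) (k : K) :
    contract f (b ⊗ₜ k) =
      (f ∘ₗ (TensorProduct.mk (ZMod 2) B K).flip k).lTensor B (Coalgebra.comul b) := by
  change f.lTensor B (extCoaction B K (b ⊗ₜ k)) = _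
  rw [extCoaction_tmul, LinearMap.lTensor_comp, LinearMap.comp_apply]

theorem contract_eq_of_extCoaction (f : B ⊗[ZMod 2] K →ₗ[ZMod 2] K) {x : B ⊗[ZMod 2] K}
    (hx : extCoaction B K x = 1 ⊗ₜ x) : contract f x = 1 ⊗ₜ f x := by
  change f.lTensor B (extCoaction B K x) = _
  rw [hx, LinearMap.lTensor_tmul]

/-- The endomorphisms `contract f` are comodule maps. -/
theorem extCoaction_contract (f : B ⊗[ZMod 2] K →ₗ[ZMod 2] K) (x : B ⊗[ZMod 2] K) :
    extCoaction B K (contract f x) = (contract f).lTensor B (extCoaction B K x) := by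
  induction x using TensorProduct.induction_on with
  | zero => simp
  | add x y hx hy => simp only [map_add, hx, hy]
  | tmul b k =>
    obtain ⟨g, hg⟩ : ∃ g : B →ₗ[ZMod 2] K, g = f ∘ₗ (TensorProduct.mk (ZMod 2) B K).flip k :=
      ⟨_, rfl⟩
    have h1 : ∀ (e : B ⊗[ZMod 2] B) (z : B),
        ((TensorProduct.mk (ZMod 2) B K).flip (g z)).lTensor B e =
          (g.lTensor B).lTensor B (TensorProduct.assoc (ZMod 2) B B B (e ⊗ₜ z)) := by
      intro e z
      induction e using TensorProduct.induction_on with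
      | zero => simp
      | add x y hx hy => simp only [map_add, TensorProduct.add_tmul, hx, hy]
      | tmul a c => simp
    have h2 : ∀ c : B ⊗[ZMod 2] B, extCoaction B K (g.lTensor B c) = (g.lTensor B).lTensor B
        (TensorProduct.assoc (ZMod 2) B B B (Coalgebra.comul.rTensor B c)) := by
      intro c
      induction c using TensorProduct.induction_on with
      | zero => simp
      | add x y hx hy => simp only [map_add, hx, hy]
      | tmul a c => rw [LinearMap.lTensor_tmul, extCoaction_tmul, h1, LinearMap.rTensor_tmul]
    have h3 : contract f ∘ₗ (TensorProduct.mk (ZMod 2) B K).flip k =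
        g.lTensor B ∘ₗ Coalgebra.comul := LinearMap.ext fun z => by
      rw [hg]
      exact contract_tmul f z k
    rw [contract_tmul, ← hg, h2, Coalgebra.coassoc_apply, extCoaction_tmul,
      ← LinearMap.comp_apply (LinearMap.lTensor B (contract f)), ← LinearMap.lTensor_comp, h3,
      LinearMap.lTensor_comp, LinearMap.comp_apply]

variable (B K) in
/-- The functional `b ⊗ k ↦ ε(b) k`. -/
def extCounit : B ⊗[ZMod 2] K →ₐ[ZMod 2] K :=
  Algebra.TensorProduct.lift
    ((Algebra.ofId (ZMod 2) K).comp (Bialgebra.counitAlgHom (ZMod 2) B)) (AlgHom.id (ZMod 2) K)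
    fun _ _ => Commute.all _ _

theorem contract_extCounit (x : B ⊗[ZMod 2] K) :
    contract (extCounit B K).toLinearMap x = x := by
  induction x using TensorProduct.induction_on with
  | zero => simp
  | add x y hx hy => simp only [map_add, hx, hy]
  | tmul b k =>
    have h : ∀ c : B ⊗[ZMod 2] B, ((extCounit B K).toLinearMap ∘ₗ
        (TensorProduct.mk (ZMod 2) B K).flip k).lTensor B c =
        (LinearMap.toSpanSingleton (ZMod 2) K k).lTensor B
          ((Coalgebra.counit (R := ZMod 2) (A := B)).lTensor B c) := by
      intro c
      induction c using TensorProduct.induction_on with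
      | zero => simp
      | add x y hx hy => simp only [map_add, hx, hy]
      | tmul a c => simp [extCounit, Algebra.ofId_apply, Algebra.smul_def]
    rw [contract_tmul, h, Coalgebra.lTensor_counit_comul]
    simp

/-- The coinvariants of `B ⊗ K` are the elements `1 ⊗ k`. -/
theorem eq_of_extCoaction {x : B ⊗[ZMod 2] K} (hx : extCoaction B K x = 1 ⊗ₜ x) :
    x = 1 ⊗ₜ extCounit B K x := by
  conv_lhs => rw [← contract_extCounit x]
  exact contract_eq_of_extCoaction _ hx

section Operation

variable (θ : B →ₗ[ZMod 2] K)

/-- The right translation `b ⊗ k ↦ ∑ b' ⊗ θ(b'') k` by a `K`-valued functional `θ` on `B`, which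
is an element of the dual Hopf algebra with scalars extended to `K`. -/
def translate : Module.End (ZMod 2) (B ⊗[ZMod 2] K) :=
  contract (LinearMap.mul' (ZMod 2) K ∘ₗ θ.rTensor K)

theorem translate_tmul (b : B) (k : K) : translate θ (b ⊗ₜ k) =
    (LinearMap.mulRight (ZMod 2) k ∘ₗ θ).lTensor B (Coalgebra.comul b) := by
  rw [translate, contract_tmul]
  rfl

theorem extCoaction_translate (x : B ⊗[ZMod 2] K) :
    extCoaction B K (translate θ x) = (translate θ).lTensor B (extCoaction B K x) :=
  extCoaction_contract _ x

theorem translate_mul_tmul (x : B ⊗[ZMod 2] K) (k : K) :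
    translate θ (x * 1 ⊗ₜ k) = translate θ x * 1 ⊗ₜ k := by
  induction x using TensorProduct.induction_on with
  | zero => simp
  | add x y hx hy => simp only [map_add, add_mul, hx, hy]
  | tmul b l =>
    rw [Algebra.TensorProduct.tmul_mul_tmul, mul_one, translate_tmul, translate_tmul]
    generalize (Coalgebra.comul b : B ⊗[ZMod 2] B) = c
    induction c using TensorProduct.induction_on with
    | zero => simp
    | add x y hx hy => simp only [map_add, add_mul, hx, hy]
    | tmul a c => simp [mul_assoc]

variable {θ}

theorem translate_eq_zero (h1 : θ 1 = 0) {x : B ⊗[ZMod 2] K}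
    (hx : extCoaction B K x = 1 ⊗ₜ x) : translate θ x = 0 := by
  rw [translate, contract_eq_of_extCoaction _ hx, eq_of_extCoaction hx]
  simp [h1]

/-- A functional of square zero for the convolution gives a translation of square zero. -/
theorem translate_translate
    (h2 : LinearMap.mul' (ZMod 2) K ∘ₗ TensorProduct.map θ θ ∘ₗ Coalgebra.comul = 0)
    (x : B ⊗[ZMod 2] K) : translate θ (translate θ x) = 0 := by
  have h : (LinearMap.mul' (ZMod 2) K ∘ₗ θ.rTensor K) ∘ₗ translate θ = 0 := by
    refine TensorProduct.ext' fun b k => ?_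
    have h3 : ∀ c : B ⊗[ZMod 2] B, LinearMap.mul' (ZMod 2) K (θ.rTensor K
        ((LinearMap.mulRight (ZMod 2) k ∘ₗ θ).lTensor B c)) =
        LinearMap.mul' (ZMod 2) K (TensorProduct.map θ θ c) * k := by
      intro c
      induction c using TensorProduct.induction_on with
      | zero => simp
      | add x y hx hy => simp only [map_add, add_mul, hx, hy]
      | tmul a c => simp [mul_assoc]
    rw [LinearMap.comp_apply, translate_tmul, LinearMap.comp_apply, h3]
    have := LinearMap.congr_fun h2 b
    simp only [LinearMap.comp_apply, LinearMap.zero_apply] at this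
    rw [this, zero_mul, LinearMap.zero_apply]
  change LinearMap.lTensor B _ (extCoaction B K (translate θ x)) = 0
  rw [extCoaction_translate, ← LinearMap.comp_apply (LinearMap.lTensor B _),
    ← LinearMap.lTensor_comp, h, LinearMap.lTensor_zero, LinearMap.zero_apply]

variable (θ)

/-! ### The action of cochains by commutators -/

/-- The commutator of the translation by `θ` with the multiplication by `b`. -/
def commutator : B →ₗ[ZMod 2] Module.End (ZMod 2) (B ⊗[ZMod 2] K) :=
  (LinearMap.mulLeft (ZMod 2) (translate θ) - LinearMap.mulRight (ZMod 2) (translate θ)) ∘ₗ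
    (Algebra.lmul (ZMod 2) (B ⊗[ZMod 2] K)).toLinearMap ∘ₗ
      (Algebra.TensorProduct.includeLeft : B →ₐ[ZMod 2] B ⊗[ZMod 2] K).toLinearMap

theorem commutator_apply (b : B) (x : B ⊗[ZMod 2] K) : commutator θ b x =
    translate θ (b ⊗ₜ 1 * x) - b ⊗ₜ 1 * translate θ x := rfl

/-- The algebra homomorphism from cochains to endomorphisms of `B ⊗ K` which sends `[b]` to the
commutator of the translation by `θ` with the multiplication by `b`. -/
def rep : Cochain B →ₐ[ZMod 2] Module.End (ZMod 2) (B ⊗[ZMod 2] K) :=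
  TensorAlgebra.lift (ZMod 2) <| Submodule.liftQ _ (commutator θ) <| by
    rw [Submodule.span_singleton_le_iff_mem, LinearMap.mem_ker]
    refine LinearMap.ext fun x => ?_
    rw [commutator_apply, ← Algebra.TensorProduct.one_def, one_mul, one_mul, sub_self,
      LinearMap.zero_apply]

theorem rep_bar (b : B) : rep θ (bar B b) = commutator θ b := by
  rw [rep, bar, LinearMap.comp_apply, TensorAlgebra.lift_ι_apply]
  rfl

theorem cochain_induction {p : Cochain B → Prop}
    (scalar : ∀ r : ZMod 2, p (algebraMap (ZMod 2) (Cochain B) r)) (bar : ∀ b, p (bar B b))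
    (mul : ∀ s t, p s → p t → p (s * t)) (add : ∀ s t, p s → p t → p (s + t))
    (t : Cochain B) : p t := by
  refine TensorAlgebra.induction scalar (fun v => ?_) mul add t
  obtain ⟨b, rfl⟩ := Submodule.mkQ_surjective _ v
  exact bar b

theorem rep_mul_tmul (t : Cochain B) (x : B ⊗[ZMod 2] K) (k : K) :
    rep θ t (x * 1 ⊗ₜ k) = rep θ t x * 1 ⊗ₜ k := by
  induction t using cochain_induction generalizing x with
  | scalar r => simp
  | bar b =>
    rw [rep_bar, commutator_apply, commutator_apply, ← mul_assoc, translate_mul_tmul,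
      translate_mul_tmul, sub_mul, mul_assoc]
  | mul s t hs ht => simp only [map_mul, Module.End.mul_apply, hs, ht]
  | add s t hs ht => simp only [map_add, LinearMap.add_apply, hs, ht, add_mul]

variable {θ} in
/-- As the translation has square zero and the characteristic is two, it commutes with its
commutators. -/
theorem translate_rep
    (h2 : LinearMap.mul' (ZMod 2) K ∘ₗ TensorProduct.map θ θ ∘ₗ Coalgebra.comul = 0)
    (t : Cochain B) (x : B ⊗[ZMod 2] K) :
    translate θ (rep θ t x) = rep θ t (translate θ x) := by
  induction t using cochain_induction generalizing x with
  | scalar r => simp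
  | bar b =>
    rw [rep_bar, commutator_apply, commutator_apply, map_sub, translate_translate h2,
      translate_translate h2, zero_sub, mul_zero, sub_zero, ZModModule.neg_eq_self]
  | mul s t hs ht => simp only [map_mul, Module.End.mul_apply, hs, ht]
  | add s t hs ht => simp only [map_add, LinearMap.add_apply, hs, ht]

/-- The diagonal action of `B ⊗ Cochain B` on `B ⊗ (B ⊗ K)`. -/
def repTensor : B ⊗[ZMod 2] Cochain B →ₐ[ZMod 2]
    Module.End (ZMod 2) (B ⊗[ZMod 2] (B ⊗[ZMod 2] K)) :=
  (Module.endTensorEndAlgHom (R := ZMod 2) (S := ZMod 2) (A := ZMod 2)).comp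
    (Algebra.TensorProduct.map (Algebra.lmul (ZMod 2) B) (rep θ))

theorem repTensor_tmul (b c : B) (t : Cochain B) (x : B ⊗[ZMod 2] K) :
    repTensor θ (b ⊗ₜ t) (c ⊗ₜ x) = (b * c) ⊗ₜ rep θ t x := rfl

theorem extCoaction_tmul_one (b : B) : extCoaction B K (b ⊗ₜ 1) =
    Algebra.TensorProduct.map (AlgHom.id (ZMod 2) B)
      (Algebra.TensorProduct.includeLeft : B →ₐ[ZMod 2] B ⊗[ZMod 2] K) (Coalgebra.comul b) := by
  rw [extCoaction_tmul]
  rfl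

/-- The action of cochains on `B ⊗ K` is compatible with the coactions. -/
theorem extCoaction_rep (t : Cochain B) (x : B ⊗[ZMod 2] K) :
    extCoaction B K (rep θ t x) = repTensor θ (coaction B t) (extCoaction B K x) := by
  induction t using cochain_induction generalizing x with
  | scalar r =>
    rw [AlgHom.commutes, AlgHom.commutes, AlgHom.commutes]
    simp
  | bar b =>
    have h : ∀ (c : B ⊗[ZMod 2] B) (y : B ⊗[ZMod 2] (B ⊗[ZMod 2] K)),
        repTensor θ ((bar B).lTensor B c) y =
          (translate θ).lTensor B (Algebra.TensorProduct.map (AlgHom.id (ZMod 2) B)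
            (Algebra.TensorProduct.includeLeft : B →ₐ[ZMod 2] B ⊗[ZMod 2] K) c * y) -
          Algebra.TensorProduct.map (AlgHom.id (ZMod 2) B)
            (Algebra.TensorProduct.includeLeft : B →ₐ[ZMod 2] B ⊗[ZMod 2] K) c *
              (translate θ).lTensor B y := by
      intro c y
      induction c using TensorProduct.induction_on with
      | zero => simp
      | add c c' hc hc' =>
        simp only [map_add, LinearMap.add_apply, add_mul, hc, hc']
        abel
      | tmul a c =>
        induction y using TensorProduct.induction_on with
        | zero => simp
        | add y y' hy hy' =>
          simp only [map_add, mul_add, hy, hy']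
          abel
        | tmul e z =>
          rw [LinearMap.lTensor_tmul, repTensor_tmul, rep_bar, commutator_apply]
          simp [TensorProduct.tmul_sub]
    rw [rep_bar, commutator_apply, map_sub, extCoaction_translate, map_mul (extCoaction B K),
      map_mul (extCoaction B K), extCoaction_translate, extCoaction_tmul_one, coaction_bar, h]
  | mul s t hs ht => simp only [map_mul, Module.End.mul_apply, hs, ht]
  | add s t hs ht => simp only [map_add, LinearMap.add_apply, hs, ht]

/-- The orbit map `t ↦ t · 1` of the action of cochains on `B ⊗ K`. -/
def orbit : Cochain B →ₗ[ZMod 2] B ⊗[ZMod 2] K :=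
  LinearMap.applyₗ 1 ∘ₗ (rep θ).toLinearMap

theorem orbit_apply (t : Cochain B) : orbit θ t = rep θ t 1 := rfl

theorem extCoaction_orbit (t : Cochain B) :
    extCoaction B K (orbit θ t) = (orbit θ).lTensor B (coaction B t) := by
  rw [orbit_apply, extCoaction_rep, map_one, Algebra.TensorProduct.one_def]
  generalize coaction B t = y
  induction y using TensorProduct.induction_on with
  | zero => simp
  | add y y' hy hy' => simp only [map_add, LinearMap.add_apply, hy, hy']
  | tmul b s => rw [repTensor_tmul, LinearMap.lTensor_tmul, mul_one, orbit_apply]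

/-- A coinvariant cochain acts on `1 ⊗ K` by a scalar of `K`. -/
theorem rep_of_coaction {z : Cochain B} (hz : coaction B z = 1 ⊗ₜ z) (k : K) :
    rep θ z (1 ⊗ₜ k) = 1 ⊗ₜ (extCounit B K (orbit θ z) * k) := by
  have h : orbit θ z = 1 ⊗ₜ extCounit B K (orbit θ z) := by
    refine eq_of_extCoaction ?_
    rw [extCoaction_orbit, hz, LinearMap.lTensor_tmul]
  have h3 := rep_mul_tmul θ z 1 k
  rw [one_mul, ← orbit_apply, h, Algebra.TensorProduct.tmul_mul_tmul, one_mul] at h3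
  exact h3

/-- The map `b ⊗ t ↦ b (t · 1)`. -/
def orbitMul : B ⊗[ZMod 2] Cochain B →ₗ[ZMod 2] B ⊗[ZMod 2] K :=
  LinearMap.mul' (ZMod 2) _ ∘ₗ TensorProduct.map
    (Algebra.TensorProduct.includeLeft : B →ₐ[ZMod 2] B ⊗[ZMod 2] K).toLinearMap (orbit θ)

theorem orbitMul_tmul (b : B) (t : Cochain B) :
    orbitMul θ (b ⊗ₜ t) = b ⊗ₜ 1 * orbit θ t := rfl

theorem extCoaction_orbitMul (x : B ⊗[ZMod 2] Cochain B) :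
    extCoaction B K (orbitMul θ x) = (orbitMul θ).lTensor B (coaction3 B x) := by
  induction x using TensorProduct.induction_on with
  | zero => simp
  | add x y hx hy => simp only [map_add, hx, hy]
  | tmul b t =>
    have h : ∀ (c : B ⊗[ZMod 2] B) (y : B ⊗[ZMod 2] Cochain B),
        Algebra.TensorProduct.map (AlgHom.id (ZMod 2) B)
          (Algebra.TensorProduct.includeLeft : B →ₐ[ZMod 2] B ⊗[ZMod 2] K) c *
            (orbit θ).lTensor B y = (orbitMul θ).lTensor B (left3 B c * right3 B y) := by
      intro c y
      induction c using TensorProduct.induction_on with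
      | zero => simp
      | add c c' hc hc' => simp only [map_add, add_mul, hc, hc']
      | tmul a c =>
        induction y using TensorProduct.induction_on with
        | zero => simp
        | add y y' hy hy' => simp only [map_add, mul_add, hy, hy']
        | tmul e z => simp [left3, right3, orbitMul_tmul]
    rw [orbitMul_tmul, map_mul, extCoaction_tmul_one, extCoaction_orbit, coaction3_tmul, h]

variable {θ}

/-- As `t · 1` is killed by the translation, only the first half of the commutator contributes to
the value of `[b] t` on `1`. -/
theorem orbit_cons (h1 : θ 1 = 0)
    (h2 : LinearMap.mul' (ZMod 2) K ∘ₗ TensorProduct.map θ θ ∘ₗ Coalgebra.comul = 0)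
    (x : B ⊗[ZMod 2] Cochain B) : orbit θ (cons B x) = translate θ (orbitMul θ x) := by
  induction x using TensorProduct.induction_on with
  | zero => simp
  | add x y hx hy => simp only [map_add, hx, hy]
  | tmul b t =>
    have h3 : translate θ (orbit θ t) = 0 := by
      rw [orbit_apply, translate_rep h2, translate_eq_zero h1, map_zero]
      rw [map_one, Algebra.TensorProduct.one_def]
    rw [cons_tmul, orbitMul_tmul, orbit_apply, map_mul, Module.End.mul_apply, rep_bar,
      commutator_apply, ← orbit_apply, h3, mul_zero, sub_zero]

/-- Coboundaries act trivially on `1`: `∂t · 1` is the translate of `∑ χ(t') (t'' · 1)`, which is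
invariant. -/
theorem orbit_d (h1 : θ 1 = 0)
    (h2 : LinearMap.mul' (ZMod 2) K ∘ₗ TensorProduct.map θ θ ∘ₗ Coalgebra.comul = 0)
    (t : Cochain B) : orbit θ (d B t) = 0 := by
  rw [d_apply, orbit_cons h1 h2]
  refine translate_eq_zero h1 ?_
  rw [extCoaction_orbitMul, coaction3_twist, LinearMap.lTensor_tmul]

variable (θ) in
/-- The scalar by which a cocycle acts on `1`. It is multiplicative, since the action of cochains
is `K`-linear. -/
def detectCocycle : cocycles B →ₐ[ZMod 2] K :=
  AlgHom.ofLinearMap ((extCounit B K).toLinearMap ∘ₗ orbit θ ∘ₗ (cocycles B).val.toLinearMap)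
    (by
      change extCounit B K (orbit θ 1) = 1
      rw [orbit_apply, map_one (rep θ), Module.End.one_apply, map_one])
    (by
      rintro ⟨y, hy⟩ ⟨z, hz⟩
      change extCounit B K (orbit θ (y * z)) =
        extCounit B K (orbit θ y) * extCounit B K (orbit θ z)
      rw [orbit_apply, map_mul, Module.End.mul_apply, Algebra.TensorProduct.one_def,
        rep_of_coaction θ ((d_eq_zero_iff z).1 hz), rep_of_coaction θ ((d_eq_zero_iff y).1 hy)]
      simp [extCounit])

/-- A functional `θ` with values in a commutative algebra `K`, vanishing on `1` and of square zero
for the convolution, is a square-zero element of the dual Hopf algebra with scalars extended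
to `K`. Restriction to the exterior algebra which it generates, whose cohomology is polynomial on
one generator, and evaluation of this generator at `1` give a homomorphism from the cohomology
to `K`. -/
def detect (θ : B →ₗ[ZMod 2] K) (h1 : θ 1 = 0)
    (h2 : LinearMap.mul' (ZMod 2) K ∘ₗ TensorProduct.map θ θ ∘ₗ Coalgebra.comul = 0) :
    Cohomology B →ₐ[ZMod 2] K :=
  Ideal.Quotient.liftₐ (coboundaries B) (detectCocycle θ) <| by
    rintro ⟨z, hz⟩ ⟨c, hc⟩
    change extCounit B K (orbit θ z) = 0
    rw [← show d B c = z from hc, orbit_d h1 h2, map_zero]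

theorem detect_primitiveClass (h1 : θ 1 = 0)
    (h2 : LinearMap.mul' (ZMod 2) K ∘ₗ TensorProduct.map θ θ ∘ₗ Coalgebra.comul = 0)
    (b : B) (hb : Coalgebra.comul b = b ⊗ₜ[ZMod 2] 1 + 1 ⊗ₜ b) :
    detect θ h1 h2 (primitiveClass B b hb) = θ b := by
  change extCounit B K (orbit θ (bar B b)) = θ b
  have h3 : translate θ (1 : B ⊗[ZMod 2] K) = 0 := translate_eq_zero h1 (by
    rw [map_one, Algebra.TensorProduct.one_def])
  rw [orbit_apply, rep_bar, commutator_apply, mul_one, h3, mul_zero, sub_zero, translate_tmul, hb]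
  simp [h1, extCounit]

end Operation

/-! ### Commutativity -/

/-- Classes of primitive elements commute: the product of the two elements cobounds the
commutator. -/
theorem primitiveClass_mul_comm (a b : B) (ha : Coalgebra.comul a = a ⊗ₜ[ZMod 2] 1 + 1 ⊗ₜ a)
    (hb : Coalgebra.comul b = b ⊗ₜ[ZMod 2] 1 + 1 ⊗ₜ b) :
    primitiveClass B a ha * primitiveClass B b hb =
      primitiveClass B b hb * primitiveClass B a ha := by
  -- The antipode negates primitive elements, and the characteristic is two.
  have hχ : ∀ c : B, Coalgebra.comul c = c ⊗ₜ[ZMod 2] 1 + 1 ⊗ₜ c →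
      bar B (antipode (ZMod 2) c) = bar B c := by
    intro c hc
    have h := mul_antipode_rTensor_comul_apply (R := ZMod 2) c
    rw [hc, map_add, LinearMap.rTensor_tmul, LinearMap.rTensor_tmul, map_add,
      LinearMap.mul'_apply, LinearMap.mul'_apply, mul_one, antipode_one, one_mul] at h
    have h2 := congrArg (bar B) h
    rw [map_add, Algebra.algebraMap_eq_smul_one, map_smul, bar_one, smul_zero] at h2
    rw [eq_neg_of_add_eq_zero_left h2, ZModModule.neg_eq_self]
  rw [← sub_eq_zero, primitiveClass, primitiveClass, ← map_mul, ← map_mul, ← map_sub]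
  refine Ideal.Quotient.eq_zero_iff_mem.2 ⟨bar B (a * b), ?_⟩
  change d B (bar B (a * b)) = bar B a * bar B b - bar B b * bar B a
  have hab : Coalgebra.comul (R := ZMod 2) (a * b) =
      (a * b) ⊗ₜ[ZMod 2] 1 + a ⊗ₜ b + (b ⊗ₜ a + 1 ⊗ₜ (a * b)) := by
    rw [Bialgebra.comul_mul, ha, hb]
    simp only [mul_add, add_mul, Algebra.TensorProduct.tmul_mul_tmul, mul_one, one_mul]
    abel
  rw [d, LinearMap.comp_apply, LinearMap.comp_apply, AlgHom.toLinearMap_apply, coaction_bar, hab]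
  simp only [map_add, LinearMap.lTensor_tmul, LinearMap.rTensor_tmul, cons_tmul, bar_one, mul_zero,
    hχ a ha, hχ b hb, antipode_one, zero_mul, zero_add, add_zero]
  rw [sub_eq_add_neg, ZModModule.neg_eq_self]

end HopfBar

/-! ### Functionals on `E(m)^*` and algebraic independence -/

theorem DualSteenrod.induction_on {p : DualSteenrod → Prop}
    (scalar : ∀ r : ZMod 2, p (algebraMap (ZMod 2) DualSteenrod r))
    (add : ∀ x y, p x → p y → p (x + y)) (mul_xi : ∀ x n, p x → p (x * xi (n + 1)))
    (x : DualSteenrod) : p x :=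
  MvPolynomial.induction_on (R := ZMod 2) (σ := ℕ) (motive := p) x scalar add mul_xi

/-- The basis of monomials of the dual Steenrod algebra; the entry with index `i` of an exponent
is the exponent of `ξ_{i+1}`. -/
def DualSteenrod.monomialBasis : Module.Basis (ℕ →₀ ℕ) (ZMod 2) DualSteenrod :=
  (MvPolynomial.basisMonomials ℕ (ZMod 2) :
    Module.Basis (ℕ →₀ ℕ) (ZMod 2) (MvPolynomial ℕ (ZMod 2)))

theorem DualSteenrod.monomialBasis_mul (d e : ℕ →₀ ℕ) :
    monomialBasis d * monomialBasis e = monomialBasis (d + e) := by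
  have h : (MvPolynomial.monomial d (1 : ZMod 2)) * MvPolynomial.monomial e 1 =
      MvPolynomial.monomial (d + e) 1 := by
    rw [MvPolynomial.monomial_mul, mul_one]
  have hb : ∀ d, MvPolynomial.monomial d (1 : ZMod 2) = MvPolynomial.basisMonomials ℕ (ZMod 2) d :=
    fun d => (congrFun (MvPolynomial.coe_basisMonomials ℕ (ZMod 2)) d).symm
  simp only [hb] at h
  exact h

theorem DualSteenrod.xi_succ_pow (n k : ℕ) :
    xi (n + 1) ^ k = monomialBasis (Finsupp.single n k) := by
  have h : (MvPolynomial.X n : MvPolynomial ℕ (ZMod 2)) ^ k =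
      MvPolynomial.monomial (Finsupp.single n k) 1 := MvPolynomial.X_pow_eq_monomial
  have hb : ∀ d, MvPolynomial.monomial d (1 : ZMod 2) = MvPolynomial.basisMonomials ℕ (ZMod 2) d :=
    fun d => (congrFun (MvPolynomial.coe_basisMonomials ℕ (ZMod 2)) d).symm
  simp only [hb] at h
  exact h

theorem DualSteenrod.monomialBasis_zero : monomialBasis 0 = 1 := by
  rw [← Finsupp.single_zero 0, ← xi_succ_pow, pow_zero]

/-- A commuting family of elements of a possibly noncommutative algebra is the image of the
variables under a homomorphism from the polynomial algebra. -/
theorem MvPolynomial.exists_algHom_of_commute {R A ι : Type*} [CommRing R] [Ring A] [Algebra R A]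
    (a : ι → A) (ha : ∀ i j, a i * a j = a j * a i) :
    ∃ φ : MvPolynomial ι R →ₐ[R] A, ∀ i, φ (MvPolynomial.X i) = a i := by
  have hcomm := Algebra.isMulCommutative_adjoin R (s := Set.range a) (by
    rintro _ ⟨i, rfl⟩ _ ⟨j, rfl⟩
    exact ha i j)
  let _ : CommRing (Algebra.adjoin R (Set.range a)) :=
    { (inferInstance : Ring (Algebra.adjoin R (Set.range a))) with
      mul_comm := fun x y => hcomm.is_comm.comm x y }
  refine ⟨(Algebra.adjoin R (Set.range a)).val.comp
    (MvPolynomial.aeval fun i => ⟨a i, Algebra.subset_adjoin ⟨i, rfl⟩⟩), fun i => ?_⟩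
  rw [AlgHom.comp_apply, MvPolynomial.aeval_X]
  rfl

namespace ElementaryDual

open DualSteenrod

variable {m : ℕ} {K : Type*} [CommRing K] [Algebra (ZMod 2) K]

theorem proj_surjective (m : ℕ) : Function.Surjective (proj m) :=
  Ideal.Quotient.mk_surjective

theorem comul_proj_X (n : ℕ) : Coalgebra.comul (R := ZMod 2) (proj m (xi (n + 1))) =
    proj m (xi (n + 1)) ⊗ₜ[ZMod 2] 1 + 1 ⊗ₜ proj m (xi (n + 1)) := by
  have h := comul_proj_xi (m := m) (Nat.succ_pos n) 0
  rwa [pow_zero, pow_one] at h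

instance : Coalgebra.IsCocomm (ZMod 2) (ElementaryDual m) where
  comm_comp_comul := by
    suffices h : ((Algebra.TensorProduct.comm (ZMod 2) (ElementaryDual m)
        (ElementaryDual m)).toAlgHom.comp (Bialgebra.comulAlgHom (ZMod 2) (ElementaryDual m))).comp
          (proj m : DualSteenrod →ₐ[ZMod 2] ElementaryDual m) =
        (Bialgebra.comulAlgHom (ZMod 2) (ElementaryDual m)).comp
          (proj m : DualSteenrod →ₐ[ZMod 2] ElementaryDual m) by
      refine LinearMap.ext fun b => ?_
      obtain ⟨x, rfl⟩ := proj_surjective m b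
      exact DFunLike.congr_fun h x
    refine hom_ext fun n => ?_
    cases n with
    | zero => simp
    | succ n =>
      change TensorProduct.comm (ZMod 2) _ _
        (Coalgebra.comul (R := ZMod 2) (proj m (xi (n + 1)))) =
          Coalgebra.comul (R := ZMod 2) (proj m (xi (n + 1)))
      rw [comul_proj_X, map_add, TensorProduct.comm_tmul, TensorProduct.comm_tmul, add_comm]

/-- The augmentation ideal of `E(m)` consists of elements of square zero, also after extension of
scalars. By cocommutativity, the convolution square of `θ` evaluated on `x p`, with `x` primitive,
is a sum of two equal terms. -/
theorem convolution_square_eq_zero (θ : ElementaryDual m →ₗ[ZMod 2] K) (h1 : θ 1 = 0) :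
    LinearMap.mul' (ZMod 2) K ∘ₗ TensorProduct.map θ θ ∘ₗ Coalgebra.comul = 0 := by
  set ω := LinearMap.mul' (ZMod 2) K ∘ₗ TensorProduct.map θ θ with hω
  have hsymm : ∀ c, ω (TensorProduct.comm (ZMod 2) _ _ c) = ω c := by
    intro c
    induction c using TensorProduct.induction_on with
    | zero => simp
    | add x y hx hy => simp only [map_add, hx, hy]
    | tmul a b => simp [hω, mul_comm]
  have hprim : ∀ x p : ElementaryDual m,
      Coalgebra.comul x = x ⊗ₜ[ZMod 2] 1 + 1 ⊗ₜ x → ω (Coalgebra.comul (x * p)) = 0 := by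
    intro x p hx
    have h : ∀ c, TensorProduct.comm (ZMod 2) (ElementaryDual m) (ElementaryDual m)
        (x ⊗ₜ 1 * c) = 1 ⊗ₜ x * TensorProduct.comm (ZMod 2) _ _ c := by
      intro c
      induction c using TensorProduct.induction_on with
      | zero => simp
      | add x y hx hy => simp only [map_add, mul_add, hx, hy]
      | tmul a b => simp
    rw [Bialgebra.comul_mul, hx, add_mul, map_add, ← hsymm (x ⊗ₜ 1 * _), h,
      Coalgebra.comm_comul, ZModModule.add_self]
  refine LinearMap.ext fun b => ?_
  obtain ⟨x, rfl⟩ := proj_surjective m b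
  change ω (Coalgebra.comul (proj m x)) = 0
  induction x using DualSteenrod.induction_on with
  | scalar r =>
    rw [AlgHomClass.commutes, Algebra.algebraMap_eq_smul_one, map_smul, map_smul,
      Bialgebra.comul_one, Algebra.TensorProduct.one_def]
    simp [hω, h1]
  | add x y hx hy => rw [map_add, map_add, map_add, hx, hy, add_zero]
  | mul_xi x n _ =>
    rw [map_mul, mul_comm]
    exact hprim _ _ (comul_proj_X n)

/-- The exponent of the monomial `ξ_t^{2^s}`. -/
def exponent (p : Index m) : ℕ →₀ ℕ := Finsupp.single (p.1.1 - 1) (2 ^ p.1.2)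

theorem exponent_injective (hm : 1 ≤ m) : Function.Injective (exponent (m := m)) := by
  rintro ⟨⟨t, s⟩, hs, ht⟩ ⟨⟨t', s'⟩, hs', ht'⟩ h
  dsimp only at hs ht hs' ht'
  have h0 : ∀ n, (2 ^ n : ℕ) ≠ 0 := fun n => by positivity
  rcases (Finsupp.single_eq_single_iff _ _ _ _).1 h with ⟨h1, h2⟩ | ⟨h1, _⟩
  · have h3 : s = s' := Nat.pow_right_injective le_rfl h2
    have h4 : t = t' := by
      dsimp only at h1
      omega
    subst h3 h4
    rfl
  · exact absurd h1 (h0 _)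

variable (m) in
/-- The functional on the dual Steenrod algebra, with values in the polynomial ring on the
variables indexed by the pairs `s < m ≤ t`, which sends the monomial `ξ_t^{2^s}` to the variable
with index `(t, s)` and all other monomials to zero. -/
def monomialFunctional : DualSteenrod →ₗ[ZMod 2] MvPolynomial (Index m) (ZMod 2) :=
  monomialBasis.constr (ZMod 2) (Function.extend exponent MvPolynomial.X 0)

theorem monomialFunctional_monomialBasis (d : ℕ →₀ ℕ) :
    monomialFunctional m (monomialBasis d) = Function.extend exponent MvPolynomial.X 0 d :=
  monomialBasis.constr_basis _ _ _

theorem monomialFunctional_xi_pow (p : Index m) :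
    monomialFunctional m (xi p.1.1 ^ 2 ^ p.1.2) = MvPolynomial.X p := by
  have hm : 1 ≤ m := lt_of_le_of_lt (Nat.zero_le _) p.2.1
  obtain ⟨n, hn⟩ := Nat.exists_eq_add_of_le' (hm.trans p.2.2)
  rw [hn, xi_succ_pow, monomialFunctional_monomialBasis,
    show Finsupp.single n (2 ^ p.1.2) = exponent p by rw [exponent, hn, Nat.add_sub_cancel],
    (exponent_injective hm).extend_apply]

theorem monomialFunctional_one : monomialFunctional m 1 = 0 := by
  rw [← monomialBasis_zero, monomialFunctional_monomialBasis]
  refine Function.extend_apply' _ _ _ ?_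
  rintro ⟨p, hp⟩
  have := DFunLike.congr_fun hp (p.1.1 - 1)
  simp [exponent] at this

theorem monomialFunctional_mul_xi_pow {n k : ℕ} (hk : k ≠ 0)
    (h : ∀ p : Index m, p.1.1 = n + 1 → 2 ^ p.1.2 < k) (x : DualSteenrod) :
    monomialFunctional m (x * xi (n + 1) ^ k) = 0 := by
  suffices h2 : monomialFunctional m ∘ₗ LinearMap.mulRight (ZMod 2) (xi (n + 1) ^ k) = 0 from
    LinearMap.congr_fun h2 x
  refine monomialBasis.ext fun d => ?_
  rw [LinearMap.comp_apply, LinearMap.mulRight_apply, xi_succ_pow, monomialBasis_mul,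
    monomialFunctional_monomialBasis]
  refine Function.extend_apply' _ _ _ ?_
  rintro ⟨p, hp⟩
  have h4 := DFunLike.congr_fun hp n
  rw [exponent, Finsupp.add_apply, Finsupp.single_eq_same, Finsupp.single_apply] at h4
  have hp1 := p.2.1
  have hp2 := p.2.2
  split_ifs at h4 with h5
  · have := h p (by omega)
    omega
  · omega

theorem monomialFunctional_of_mem {x : DualSteenrod} (hx : x ∈ elementaryIdeal m) :
    monomialFunctional m x = 0 := by
  suffices h : ∀ y, monomialFunctional m (y * x) = 0 by simpa using h 1
  induction hx using Submodule.span_induction with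
  | mem x hx =>
    rcases hx with ⟨t, h0, ht, rfl⟩ | ⟨t, h0, ht, rfl⟩
    · obtain ⟨n, rfl⟩ := Nat.exists_eq_add_of_le' h0
      intro y
      rw [← pow_one (xi (n + 1))]
      refine monomialFunctional_mul_xi_pow one_ne_zero (fun p hp => ?_) y
      have := p.2.2
      omega
    · obtain ⟨n, rfl⟩ := Nat.exists_eq_add_of_le' h0
      exact monomialFunctional_mul_xi_pow (by positivity)
        fun p _ => Nat.pow_lt_pow_right one_lt_two p.2.1
  | zero => simp
  | add x y _ _ hx hy =>
    intro z
    rw [mul_add, map_add, hx, hy, add_zero]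
  | smul a x _ hx =>
    intro y
    rw [smul_eq_mul, ← mul_assoc, hx]

/-- The elements `ξ_t^{2^s}` with `s < m ≤ t` are linearly independent modulo `1`, so that a
functional vanishing on `1` can be prescribed arbitrarily on them. -/
theorem exists_functional (m : ℕ) :
    ∃ θ : ElementaryDual m →ₗ[ZMod 2] MvPolynomial (Index m) (ZMod 2),
      θ 1 = 0 ∧ ∀ p : Index m, θ (proj m (xi p.1.1 ^ 2 ^ p.1.2)) = MvPolynomial.X p := by
  let π : DualSteenrod →ₗ[ZMod 2] ElementaryDual m := (proj m : DualSteenrod →ₗ[ZMod 2] _)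
  have hπ : Function.Surjective π := proj_surjective m
  have hker : LinearMap.ker π ≤ LinearMap.ker (monomialFunctional m) := fun x hx =>
    monomialFunctional_of_mem (Ideal.Quotient.eq_zero_iff_mem.1 hx)
  let θ := (LinearMap.ker π).liftQ (monomialFunctional m) hker ∘ₗ
      (π.quotKerEquivOfSurjective hπ).symm.toLinearMap
  have hθ : ∀ x, θ (proj m x) = monomialFunctional m x := by
    intro x
    have h : (π.quotKerEquivOfSurjective hπ).symm (π x) = (LinearMap.ker π).mkQ x := by
      rw [LinearEquiv.symm_apply_eq]
      rfl
    change (LinearMap.ker π).liftQ (monomialFunctional m) hker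
      ((π.quotKerEquivOfSurjective hπ).symm (π x)) = _
    rw [h]
    rfl
  refine ⟨θ, ?_, fun p => ?_⟩
  · rw [← map_one (proj m), hθ, monomialFunctional_one]
  · rw [hθ, monomialFunctional_xi_pow]

/-- The classes `h_{t,s}` generate a polynomial subalgebra. -/
theorem exists_injective_algHom (m : ℕ) :
    ∃ φ : MvPolynomial (Index m) (ZMod 2) →ₐ[ZMod 2] HopfBar.Cohomology (ElementaryDual m),
      Function.Injective φ ∧ ∀ p, φ (MvPolynomial.X p) = h m p := by
  obtain ⟨θ, h1, h2⟩ := exists_functional m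
  let D := HopfBar.detect θ h1 (convolution_square_eq_zero θ h1)
  obtain ⟨φ, hφ⟩ := MvPolynomial.exists_algHom_of_commute (R := ZMod 2) (h m) fun p q =>
    HopfBar.primitiveClass_mul_comm _ _ _ _
  have hD : D.comp φ = AlgHom.id (ZMod 2) _ := by
    refine MvPolynomial.algHom_ext fun p => ?_
    rw [AlgHom.comp_apply, hφ, AlgHom.id_apply, ← h2 p]
    exact HopfBar.detect_primitiveClass h1 _ _ _
  exact ⟨φ, Function.LeftInverse.injective (g := D) fun F => DFunLike.congr_fun hD F, hφ⟩

end ElementaryDual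

/-! ### The transfer -/

namespace Transfer

open DualSteenrod HopfBar

/-- The coefficients of a square, by the Frobenius endomorphism in characteristic two. -/
theorem coeff_sq (g : PowerSeries DualSteenrod) (n : ℕ) :
    PowerSeries.coeff n (g ^ 2) = if 2 ∣ n then PowerSeries.coeff (n / 2) g ^ 2 else 0 := by
  have h : PowerSeries.map (iterateFrobenius DualSteenrod 2 1)
      (PowerSeries.expand (2 ^ 1) (pow_ne_zero 1 two_ne_zero) g) = g ^ 2 ^ 1 :=
    MvPowerSeries.map_iterateFrobenius_expand 2 two_ne_zero g 1
  refine (congrArg (PowerSeries.coeff n) h.symm).trans ?_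
  rw [PowerSeries.coeff_map, PowerSeries.coeff_expand, pow_one]
  split_ifs
  · rw [iterateFrobenius_def, pow_one]
  · exact map_zero _

theorem coeff_unitSeries_even {n : ℕ} (hn : n ≠ 0) (h : 2 ∣ n) :
    PowerSeries.coeff n unitSeries = 0 := by
  rw [unitSeries, PowerSeries.coeff_mk]
  refine Finset.sum_eq_zero fun t _ => if_neg fun ht => ?_
  cases t with
  | zero => omega
  | succ t =>
    rw [pow_succ] at ht
    omega

/-- All exponents of `unitSeries` except zero are odd, and those of a square are even. -/
theorem coeff_unitSeries_mul_sq (g : PowerSeries DualSteenrod) (n : ℕ) :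
    PowerSeries.coeff (2 * n) (unitSeries * g ^ 2) = PowerSeries.coeff n g ^ 2 := by
  rw [PowerSeries.coeff_mul, Finset.sum_eq_single (0, 2 * n)]
  · dsimp only
    rw [PowerSeries.coeff_zero_eq_constantCoeff_apply, constantCoeff_unitSeries, one_mul, coeff_sq,
      if_pos (dvd_mul_right 2 n), Nat.mul_div_cancel_left _ two_pos]
  · rintro ⟨a, b⟩ h1 h2
    rw [Finset.HasAntidiagonal.mem_antidiagonal] at h1
    dsimp only at h1 ⊢
    by_cases hb : 2 ∣ b
    · rw [coeff_unitSeries_even _ (by omega), zero_mul]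
      rintro rfl
      exact h2 (by rw [← h1, zero_add])
    · rw [coeff_sq, if_neg hb, mul_zero]
  · intro h
    exact absurd (Finset.HasAntidiagonal.mem_antidiagonal.2 (zero_add _)) h

theorem coeff_invSeries_two_mul (n : ℕ) :
    PowerSeries.coeff (2 * n) invSeries = PowerSeries.coeff n invSeries ^ 2 := by
  rw [← coeff_unitSeries_mul_sq, sq, ← mul_assoc, unit_mul_inv, one_mul]

theorem coeff_genSeries_pow_odd (k j : ℕ) :
    PowerSeries.coeff (2 * k + 1) (genSeries ^ (2 * j + 1)) =
      PowerSeries.coeff k (genSeries ^ j) ^ 2 := by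
  rw [pow_succ', mul_comm 2 j, pow_mul]
  conv_lhs => rw [genSeries, mul_assoc, PowerSeries.coeff_succ_X_mul]
  exact coeff_unitSeries_mul_sq _ _

theorem coeff_genSeries_pow_even (k j : ℕ) :
    PowerSeries.coeff (2 * k + 1) (genSeries ^ (2 * j)) = 0 := by
  rw [mul_comm 2 j, pow_mul, coeff_sq, if_neg (by omega)]

end Transfer

namespace ElementaryDual

open DualSteenrod HopfBar Transfer

variable {m : ℕ}

/-- In `E(m)^*` the series `∑_t ξ_t x^{2^t - 1}` is `1 + ξ_m x^{2^m - 1} + ⋯`. -/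
theorem exists_map_unitSeries (m : ℕ) : ∃ v : PowerSeries (ElementaryDual m),
    PowerSeries.map (proj m : DualSteenrod →+* ElementaryDual m) unitSeries =
      1 + PowerSeries.X ^ (2 ^ m - 1) * v := by
  have h : PowerSeries.X ^ (2 ^ m - 1) ∣
      PowerSeries.map (proj m : DualSteenrod →+* ElementaryDual m) unitSeries - 1 := by
    rw [PowerSeries.X_pow_dvd_iff]
    intro n hn
    rw [map_sub, PowerSeries.coeff_map, PowerSeries.coeff_one]
    split_ifs with h0
    · rw [h0, PowerSeries.coeff_zero_eq_constantCoeff_apply, constantCoeff_unitSeries, map_one,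
        sub_self]
    · rw [sub_zero, unitSeries, PowerSeries.coeff_mk, map_sum]
      refine Finset.sum_eq_zero fun t _ => ?_
      split_ifs with ht
      · refine Ideal.Quotient.eq_zero_iff_mem.2 (elementaryIdeal.xi_mem ?_ ?_)
        · rcases Nat.eq_zero_or_pos t with rfl | h1
          · omega
          · exact h1
        · exact (Nat.pow_lt_pow_iff_right one_lt_two).1 (by omega)
      · exact map_zero _
  obtain ⟨v, hv⟩ := h
  exact ⟨v, by rw [← hv, add_sub_cancel]⟩

/-- The value of the chain-level transfer on `b_k` for `k + 1 = 2^s (2^m - 1)`. -/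
theorem proj_coeff_invSeries (hm : 1 ≤ m) (s : ℕ) :
    proj m (PowerSeries.coeff (2 ^ s * (2 ^ m - 1)) invSeries) = proj m (xi m ^ 2 ^ s) := by
  induction s with
  | zero =>
    obtain ⟨v, hv⟩ := exists_map_unitSeries m
    obtain ⟨N, hN⟩ : ∃ N, 2 ^ m = N + 1 + 1 :=
      Nat.exists_eq_add_of_le' (le_self_pow₀ one_le_two (by omega))
    have h0 : PowerSeries.constantCoeff
        (PowerSeries.map (proj m : DualSteenrod →+* ElementaryDual m) invSeries) = 1 := by
      rw [← PowerSeries.coeff_zero_eq_constantCoeff_apply, PowerSeries.coeff_map,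
        PowerSeries.coeff_zero_eq_constantCoeff_apply, invSeries,
        PowerSeries.constantCoeff_invOfUnit, inv_one, Units.val_one, map_one]
    have h1 := congrArg (PowerSeries.map (proj m : DualSteenrod →+* ElementaryDual m)) unit_mul_inv
    rw [hN, Nat.add_sub_cancel] at hv ⊢
    rw [map_mul, map_one, hv, add_mul, one_mul, mul_assoc] at h1
    have h2 := congrArg (PowerSeries.coeff (0 + (N + 1))) h1
    have h3 := congrArg (PowerSeries.coeff (0 + (N + 1))) hv
    have h4 : PowerSeries.coeff (N + 1) unitSeries = xi m := by
      rw [← coeff_genSeries_two_pow, hN, genSeries, PowerSeries.coeff_succ_X_mul]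
    rw [map_add, PowerSeries.coeff_X_pow_mul, PowerSeries.coeff_zero_eq_constantCoeff_apply,
      map_mul, h0, mul_one, zero_add, PowerSeries.coeff_one, if_neg (Nat.succ_ne_zero N),
      PowerSeries.coeff_map] at h2
    rw [map_add, PowerSeries.coeff_X_pow_mul, PowerSeries.coeff_zero_eq_constantCoeff_apply,
      zero_add, PowerSeries.coeff_one, if_neg (Nat.succ_ne_zero N), zero_add,
      PowerSeries.coeff_map, h4] at h3
    rw [← h3] at h2
    rw [pow_zero, one_mul, pow_one]
    refine (eq_neg_of_add_eq_zero_left h2).trans ?_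
    exact ZModModule.neg_eq_self _
  | succ s ih =>
    rw [pow_succ', mul_assoc, coeff_invSeries_two_mul, map_pow, ih, ← map_pow, ← pow_mul,
      mul_comm (2 ^ s)]

/-- With `k + 1 = 2^s (2^m - 1)`, the class `b_k` is coinvariant: no power `x^j` with `j < k`
supports an operation of `E(m)` with target `x^k`. -/
theorem proj_coeff_genSeries_pow (hm : 1 ≤ m) {s k j : ℕ} (hk : k + 1 = 2 ^ s * (2 ^ m - 1))
    (hj : j < k) : proj m (PowerSeries.coeff k (genSeries ^ j)) = 0 := by
  have hm2 : 2 ≤ 2 ^ m := le_self_pow₀ one_le_two (by omega)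
  induction s generalizing k j with
  | zero =>
    obtain ⟨v, hv⟩ := exists_map_unitSeries m
    -- The coefficient of `x^k` in `(x u)^j` is that of `x^{k-j}` in `u^j`, and `0 < k - j < 2^m - 1`.
    obtain ⟨n, rfl⟩ := Nat.exists_eq_add_of_lt hj
    have hdvd : PowerSeries.X ^ (2 ^ m - 1) ∣
        PowerSeries.map (proj m : DualSteenrod →+* ElementaryDual m) unitSeries ^ j - 1 := by
      refine dvd_trans ?_ (sub_one_dvd_pow_sub_one _ _)
      rw [hv, add_sub_cancel_left]
      exact dvd_mul_right _ _
    have h := PowerSeries.X_pow_dvd_iff.1 hdvd (n + 1) (by omega)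
    rw [map_sub, PowerSeries.coeff_one, if_neg (Nat.succ_ne_zero n), sub_zero, ← map_pow,
      PowerSeries.coeff_map] at h
    rw [genSeries, mul_pow, add_assoc, add_comm j, PowerSeries.coeff_X_pow_mul]
    exact h
  | succ s ih =>
    have hpos : 0 < 2 ^ s * (2 ^ m - 1) := Nat.mul_pos (by positivity) (by omega)
    obtain ⟨k', hk'⟩ := Nat.exists_eq_add_of_le' hpos
    obtain rfl : k = 2 * k' + 1 := by
      rw [pow_succ', mul_assoc] at hk
      omega
    rcases Nat.even_or_odd' j with ⟨i, rfl | rfl⟩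
    · rw [coeff_genSeries_pow_even, map_zero]
    · rw [coeff_genSeries_pow_odd, map_pow, ih hk'.symm (by omega), zero_pow two_ne_zero]

theorem b_mem_annihilated (hm : 1 ≤ m) {s k : ℕ} (hk : k + 1 = 2 ^ s * (2 ^ m - 1)) :
    b k ∈ annihilated (proj m) := by
  change ∀ θ : Module.Dual (ZMod 2) (ElementaryDual m), θ 1 = 0 → act (proj m) (b k) θ = 0
  rw [forall_act_eq_zero_iff, coaction_b, Finset.sum_eq_single k]
  · have h : PowerSeries.coeff (0 + k) (genSeries ^ k) = 1 := by
      rw [genSeries, mul_pow, PowerSeries.coeff_X_pow_mul,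
        PowerSeries.coeff_zero_eq_constantCoeff_apply, map_pow, constantCoeff_unitSeries, one_pow]
    rw [zero_add] at h
    rw [h, map_one]
  · intro j hj hjk
    rw [Finset.mem_range] at hj
    rw [proj_coeff_genSeries_pow hm hk (by omega), TensorProduct.zero_tmul]
  · intro h
    exact absurd (Finset.mem_range.2 (Nat.lt_succ_self k)) h

theorem h_mem_range_transfer (p : Index m) (hp : p.1.1 = m) :
    h m p ∈ (transfer (proj m)).range := by
  have hm : 1 ≤ m := lt_of_le_of_lt (Nat.zero_le _) p.2.1
  have hm2 : 2 ≤ 2 ^ m := le_self_pow₀ one_le_two (by omega)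
  obtain ⟨k, hk⟩ := Nat.exists_eq_add_of_le'
    (show 1 ≤ 2 ^ p.1.2 * (2 ^ m - 1) from Nat.mul_pos (by positivity) (by omega))
  refine ⟨⟨b k, b_mem_annihilated hm hk.symm⟩, ?_⟩
  refine congrArg (classOf (ElementaryDual m)) (Subtype.ext ?_)
  change chainMap (proj m) (b k) = bar _ (proj m (xi p.1.1 ^ 2 ^ p.1.2))
  rw [chainMap_b, ← hk, proj_coeff_invSeries hm, hp]

end ElementaryDual

end

theorem mainTheorem3 (m : ℕ) (hm : 1 ≤ m) :
    (∃ φ : MvPolynomial (ElementaryDual.Index m) (ZMod 2) →ₐ[ZMod 2]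
        HopfBar.Cohomology (ElementaryDual m),
      Function.Injective φ ∧ ∀ p, φ (MvPolynomial.X p) = ElementaryDual.h m p) ∧
    Algebra.adjoin (ZMod 2)
        {c | ∃ p : ElementaryDual.Index m, p.1.1 = m ∧ c = ElementaryDual.h m p} ≤
      (transfer (ElementaryDual.proj m)).range := by
  refine ⟨ElementaryDual.exists_injective_algHom m, Algebra.adjoin_le ?_⟩
  rintro _ ⟨p, hp, rfl⟩
  exact ElementaryDual.h_mem_range_transfer p hp
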